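/- Let $p\neq 2$ be a prime, $F/\mathbb{Q}_p$ a finite extension with ring of integers $O_F$, maximal ideal $\mathfrak p_F=\varpi_FO_F$ and residue field $\mathbb F$ of $q$ elements, and let $\psi:F\to\mathbb C^1$ be a continuous unitary additive character with $\{x\in F\mid\psi(xO_F)=1\}=O_F$. Let $K_+/F$ be a tamely ramified extension of degree $n>1$ and $K/K_+$ a quadratic extension with $\mathrm{Gal}(K/K_+)=\langle\tau\rangle$. Write $e_+=e(K_+/F)$, $f_+=f(K_+/F)$, $e=e(K/F)$, and assume that $K/K_+$ is unramified or $K/F$ is totally ramified. Let $\beta\in O_K$ with $O_K=O_F[\beta]$ and $\beta^\tau+\beta=0$, let $\omega\in O_K$ with $\omega^\tau=-\omega$ and $O_K=O_{K_+}\oplus\omega O_{K_+}$, and let $\varpi_{K_+}$ be a prime element of $K_+$. Let $D(x,y)=\frac12T_{K/F}(\omega^{-1}\varpi_{K_+}^{1-e_+}x^\tau y)$, and use a symplectic $O_F$-basis $(u_i,v_i)_{1\le i\le n}$ of $O_K$ for $D$ to regard elements of $O_K$, acting on $O_K$ by multiplication, as matrices in $M_{2n}(O_F)$. Let $G=Sp_{2n}$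 be the symplectic group of this basis, with Lie algebra $\mathfrak g$, and put $B(X,Y)=\mathrm{tr}(XY)$; then $\beta\in\mathfrak g(O_F)$. Let $G_\beta$ and $\mathfrak g_\beta$ be the centralizers of $\beta$ in $G$ and $\mathfrak g$. For $0<m<r$ let $K_m(O_F/\mathfrak p_F^r)$ be the kernel of $G(O_F/\mathfrak p_F^r)\to G(O_F/\mathfrak p_F^m)$. Let $r>1$, $l=\lceil r/2\rceil$, $l'=\lfloor r/2\rfloor$, and $U_{K/K_+}=\{\varepsilon\in O_K^\times\mid N_{K/K_+}(\varepsilon)=1\}$. Let $\theta$ be a unitary character of $U_{K/K_+}$ which factors through $(O_K/\mathfrak p_K^{er})^\times$ and satisfies $\theta(\alpha)=\psi(\varpi_F^{-l'}T_{K/F}(x\beta))$ whenever $\alpha\equiv 1+\varpi_F^lx \pmod{\mathfrak p_K^{er}}$ with $x\in O_K$, $T_{K/K_+}(x)\equiv0\pmod{\mathfrak p_{K_+}^{e_+l'}}$. Regard $\theta$ as a character of $G_\beta(O_F/\mathfrak p_F^r)$, which is the image of $U_{K/K_+}$. Put $$G(O_F/\mathfrak p_F^r;\beta)=\{g\in G(O_F/\mathfrak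 p_F^r)\mid \mathrm{Ad}(g)\beta\equiv\beta \pmod{\mathfrak p_F^{l'}}\}=G_\beta(O_F/\mathfrak p_F^r)\cdot K_{l'}(O_F/\mathfrak p_F^r),$$ and let $$\delta_{\beta,\theta}=\mathrm{Ind}_{G(O_F/\mathfrak p_F^r;\beta)}^{G(O_F/\mathfrak p_F^r)}\sigma_{\beta,\theta},$$ where $\sigma_{\beta,\theta}$ is the following representation. * If $r=2l$ is even, $\sigma_{\beta,\theta}$ is the one-dimensional representation $\sigma_{\beta,\theta}(hk)=\theta(h)\chi_\beta(k)$ for $h\in G_\beta(O_F/\mathfrak p_F^r)$, $k\in K_l(O_F/\mathfrak p_F^r)$, with $\chi_\beta(1+\varpi_F^lX)=\psi(\varpi_F^{-l'}B(X,\beta))$. * If $r=2l-1$ is odd, choose a complement $V$ of $\mathfrak g_\beta(\mathbb F)$ in $\mathfrak g(\mathbb F)$ and a polarization $V=W'\oplus W$ for the symplectic form $D_\beta(X,Y)=B([X,Y],\overline\beta)$ on $V\cong\mathfrak g(\mathbb F)/\mathfrak g_\beta(\mathbb F)$. The group $K_{l-1}(O_F/\mathfrak p_F^r)$ acts on the space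 $L^2(W')$ of complex functions on $W'$ by $$\sigma^{\beta,\theta}(1+\varpi_F^{l-1}T)=\psi\left(\varpi_F^{-l}B(T,\beta)-2^{-1}\varpi_F^{-1}B(T^2,\beta)\right)\rho_\theta(Y)\,\sigma^\beta(v,1),\qquad T\bmod\mathfrak p_F=v+Y,\ v\in V,\ Y\in\mathfrak g_\beta(\mathbb F).$$ Here $(\sigma^\beta(v,1)f)(w)=\widehat\psi(2^{-1}D_\beta(v_-,v_+)+D_\beta(w,v_+))f(w+v_-)$ for $v=v_-+v_+\in W'\oplus W$, with $\widehat\psi(\overline x)=\psi(\varpi_F^{-1}x)$, and $\rho_\theta(X\bmod\mathfrak p_F)=\psi(-\varpi_F^{-l}B(X,\beta))\,\theta(1+\varpi_F^{l-1}X+2^{-1}\varpi_F^{2l-2}X^2\bmod\mathfrak p_F^r)$ for $X\in\mathfrak g_\beta(O_F)$. Further choose a homomorphism $U:G_\beta(O_F/\mathfrak p_F^r)\to GL_{\mathbb C}(L^2(W'))$ with $\sigma^{\beta,\theta}(h^{-1}gh)=U(h)^{-1}\sigma^{\beta,\theta}(g)U(h)$ for all $g\in K_{l-1}(O_F/\mathfrak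 p_F^r)$ and $U(h)=1$ for $h\in G_\beta(O_F/\mathfrak p_F^r)\cap K_{l-1}(O_F/\mathfrak p_F^r)$. Then $\sigma_{\beta,\theta}(hg)=\theta(h)\,U(h)\circ\sigma^{\beta,\theta}(g)$ for $h\in G_\beta(O_F/\mathfrak p_F^r)$, $g\in K_{l-1}(O_F/\mathfrak p_F^r)$. Then, for every such $\theta$ and all choices made, $$\dim\delta_{\beta,\theta}=q^{n^2r}\cdot\prod_{k=1}^n\left(1-q^{-2k}\right)\times\begin{cases}\frac12&\text{if }K/F\text{ is totally ramified},\\[2pt] \frac1{1+q^{-f_+}}&\text{if }K/K_+\text{ is unramified}.\end{cases}$$ -/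

import Mathlib

noncomputable section

open Matrix Module

namespace TameSymplectic

/-- The ring of integers `O_F` of a finite extension `F` of `ℚ_p`. -/
abbrev IntF (p : ℕ) [Fact p.Prime] (F : Type*) [Field F] [Algebra ℤ_[p] F] :
    Subalgebra ℤ_[p] F :=
  integralClosure ℤ_[p] F

/-- The ring of integers `O_L` of a finite extension `L` of `F`: the integral closure of `O_F`
in `L` (equivalently, of `ℤ_p` in `L`), as an `O_F`-algebra. -/
abbrev IntExt (p : ℕ) [Fact p.Prime] (F L : Type*) [Field F] [Algebra ℤ_[p] F] [Field L]
    [Algebra F L] : Subalgebra (IntF p F) L :=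
  integralClosure (IntF p F) L

/-- The group `U_{K/K₊}` of the units of `O_K` of relative norm `1`. -/
def NormOne (p : ℕ) [Fact p.Prime] (F Kp K : Type*) [Field F] [Algebra ℤ_[p] F] [Field Kp]
    [Field K] [Algebra Kp K] [Algebra F K] : Subgroup (IntExt p F K)ˣ :=
  MonoidHom.ker (((Algebra.norm Kp : K →* Kp).comp
    ((IntExt p F K).toSubmonoid.subtype)).comp (Units.coeHom (IntExt p F K)))

/-- The `F`-bilinear form `D(x, y) = ½ T_{K/F}(ω⁻¹ ϖ₊^(1 - e₊) x^τ y)` on `K`. -/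
def formD {F K : Type*} [Field F] [Field K] [Algebra F K]
    (τ : K → K) (ω varpi : K) (e : ℕ) (x y : K) : F :=
  2⁻¹ * Algebra.trace F K (ω⁻¹ * varpi ^ (1 - (e : ℤ)) * τ x * y)

/-- `2n × 2n` matrices over `A`. -/
abbrev Mat (n : ℕ) (A : Type*) : Type _ := Matrix (Fin n ⊕ Fin n) (Fin n ⊕ Fin n) A

/-- The Lie algebra `𝔤(A) = 𝔰𝔭_{2n}(A)` of the matrices `X` with `X J + J ᵗX = 0`. -/
def lieSp (n : ℕ) (A : Type*) [CommRing A] : Submodule A (Mat n A) where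
  carrier := {X | X * Matrix.J (Fin n) A + Matrix.J (Fin n) A * Xᵀ = 0}
  zero_mem' := by simp
  add_mem' := by
    intro X Y hX hY
    simp only [Set.mem_ofPred_eq, Matrix.transpose_add, add_mul, mul_add] at hX hY ⊢
    rw [add_add_add_comm, hX, hY, add_zero]
  smul_mem' := by
    intro c X hX
    simp only [Set.mem_ofPred_eq, Matrix.transpose_smul, Matrix.smul_mul, Matrix.mul_smul,
      ← smul_add] at hX ⊢
    rw [hX, smul_zero]

/-- The centralizer of `β` in the Lie algebra `𝔤(A)`. -/
def lieCentralizer {n : ℕ} {A : Type*} [CommRing A] (β : Mat n A) : Submodule A (Mat n A) :=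
  lieSp n A ⊓ Subalgebra.toSubmodule (Subalgebra.centralizer A {β})

/-- The alternating form `D_β(X, Y) = B([X, Y], β) = tr([X, Y] β)`. -/
def formDβ {n : ℕ} {A : Type*} [CommRing A] (β X Y : Mat n A) : A :=
  Matrix.trace ((X * Y - Y * X) * β)

/-- The data attached to the tower `K / K₊ / F`, where `K / K₊` is quadratic and
`[K₊ : F] = n`. -/
structure Datum (p : ℕ) [Fact p.Prime] (F Kp K : Type*) [Field F] [Algebra ℤ_[p] F] [Field Kp]
    [Algebra F Kp] [Field K] [Algebra Kp K] [Algebra F K] (n : ℕ) where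
  /-- A generator `ϖ_F` of the maximal ideal of `O_F`. -/
  varpi : IntF p F
  isMaximal_varpi : (Ideal.span {varpi}).IsMaximal
  /-- A unitary additive character of `F` with `{x | ψ(x O_F) = 1} = O_F`. As it is trivial on the
  open subgroup `O_F`, it is automatically continuous. -/
  ψ : AddChar F Circle
  conductor_ψ : ∀ x : F, (∀ a : IntF p F, ψ (x * a) = 1) ↔ x ∈ IntF p F
  /-- A generator `ϖ_{K₊}` of the maximal ideal of `O_{K₊}`. -/
  varpiP : IntExt p F Kp
  isMaximal_varpiP : (Ideal.span {varpiP}).IsMaximal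
  /-- The maximal ideal of `O_K`. -/
  maxK : Ideal (IntExt p F K)
  isMaximal_maxK : maxK.IsMaximal
  /-- The generator of `Gal(K / K₊)`. -/
  τ : K ≃ₐ[Kp] K
  τ_ne_one : τ ≠ 1
  /-- An element `ω` of `O_K` with `ω^τ = -ω` and `O_K = O_{K₊} ⊕ ω O_{K₊}`. -/
  ω : IntExt p F K
  τ_ω : τ (ω : K) = -(ω : K)
  decomp_ω : ∀ x : IntExt p F K, ∃! c : IntExt p F Kp × IntExt p F Kp,
    (x : K) = algebraMap Kp K c.1 + (ω : K) * algebraMap Kp K c.2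
  /-- An element `β` of `O_K` with `O_K = O_F[β]` and `β^τ + β = 0`. -/
  β : IntExt p F K
  adjoin_β : Algebra.adjoin (IntF p F) {β} = ⊤
  τ_β : τ (β : K) + (β : K) = 0
  /-- A symplectic `O_F`-basis `u_i = b (inl i)`, `v_i = b (inr i)` of `O_K` with respect
  to the form `D`. -/
  b : Basis (Fin n ⊕ Fin n) (IntF p F) (IntExt p F K)
  form_uu : ∀ i j : Fin n, formD (F := F) τ ω (algebraMap Kp K varpiP)
    ((Ideal.span {varpiP}).ramificationIdx (IntF p F)) (b (.inl i)) (b (.inl j)) = 0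
  form_vv : ∀ i j : Fin n, formD (F := F) τ ω (algebraMap Kp K varpiP)
    ((Ideal.span {varpiP}).ramificationIdx (IntF p F)) (b (.inr i)) (b (.inr j)) = 0
  form_uv : ∀ i j : Fin n, formD (F := F) τ ω (algebraMap Kp K varpiP)
    ((Ideal.span {varpiP}).ramificationIdx (IntF p F)) (b (.inl i)) (b (.inr j)) =
      if i = j then 1 else 0

namespace Datum

variable {p : ℕ} [Fact p.Prime] {F Kp K : Type*} [Field F] [Algebra ℤ_[p] F] [Field Kp]
  [Algebra F Kp] [Field K] [Algebra Kp K] [Algebra F K] {n : ℕ} (D : Datum p F Kp K n)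

/-! ### Numerical invariants of the tower -/

/-- The cardinality `q` of the residue field of `F`. -/
def q : ℕ := Nat.card (IntF p F ⧸ Ideal.span {D.varpi})

/-- The maximal ideal of `O_{K₊}`. -/
def maxP : Ideal (IntExt p F Kp) := Ideal.span {D.varpiP}

/-- The ramification index `e₊ = e(K₊ / F)`. -/
def ePlus : ℕ := D.maxP.ramificationIdx (IntF p F)

/-- The inertia degree `f₊ = f(K₊ / F)`. -/
def fPlus : ℕ := D.maxP.inertiaDeg (IntF p F)

/-- `K / F` is totally ramified: `e(K / F) = [K : F]`. -/
def IsTotallyRamified : Prop := D.maxK.ramificationIdx (IntF p F) = finrank F K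

/-- `K / K₊` is unramified: the maximal ideal of `O_{K₊}` generates that of `O_K`. -/
def IsUnramified : Prop :=
  ∀ x : IntExt p F K, x ∈ D.maxK ↔
    ∃ y : IntExt p F K, (x : K) = algebraMap Kp K (D.varpiP : Kp) * (y : K)

/-! ### The symplectic group over `O_F / 𝔭_F^m` -/

/-- The ring `O_F / 𝔭_F^m`. -/
abbrev R (m : ℕ) : Type _ := IntF p F ⧸ Ideal.span {D.varpi ^ m}

/-- The residue field `𝔽` of `F`. -/
abbrev Res : Type _ := IntF p F ⧸ Ideal.span {D.varpi}

/-- The group `G(O_F / 𝔭_F^m)`, `G = Sp_{2n}`, of the `g` with `g J ᵗg = J`. -/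
abbrev G (m : ℕ) : Type _ := Matrix.symplecticGroup (Fin n) (D.R m)

/-- Reduction of matrices modulo `𝔭_F^m`. -/
def redMat (m : ℕ) : Mat n (IntF p F) →+* Mat n (D.R m) :=
  (Ideal.Quotient.mk (Ideal.span {D.varpi ^ m})).mapMatrix

/-- Reduction of matrices modulo `𝔭_F`, with entries in the residue field. -/
def resMat : Mat n (IntF p F) →+* Mat n D.Res :=
  (Ideal.Quotient.mk (Ideal.span {D.varpi})).mapMatrix

/-- The reduction `O_F / 𝔭_F^r → O_F / 𝔭_F^m` for `m ≤ r`, on matrices. -/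
def transMat {m r : ℕ} (h : m ≤ r) : Mat n (D.R r) →+* Mat n (D.R m) :=
  (Ideal.Quotient.factor
    (Ideal.span_singleton_le_span_singleton.mpr (pow_dvd_pow D.varpi h))).mapMatrix

/-- The congruence subgroup `K_m(O_F / 𝔭_F^r)` of the elements of `G(O_F / 𝔭_F^r)` which are
trivial modulo `𝔭_F^m`. -/
def congrSubgroup {m r : ℕ} (h : m ≤ r) : Subgroup (D.G r) :=
  MonoidHom.ker (((D.transMat h : Mat n (D.R r) →+* Mat n (D.R m)) :
    Mat n (D.R r) →* Mat n (D.R m)).comp (Matrix.symplecticGroup (Fin n) (D.R r)).subtype)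

/-- The matrix of multiplication by `a ∈ O_K` in the symplectic basis, endomorphisms acting on
row vectors: `b i * a = ∑ j, (mat a) i j * b j`. -/
def mat (a : IntExt p F K) : Mat n (IntF p F) := (Algebra.leftMulMatrix D.b a)ᵀ

/-- The subgroup of the `g` in `G(O_F / 𝔭_F^r)` with `Ad(g) β ≡ β` modulo `𝔭_F^m`. -/
def stab {m r : ℕ} (h : m ≤ r) : Subgroup (D.G r) where
  carrier := {g | D.transMat h g * D.redMat m (D.mat D.β) =
    D.redMat m (D.mat D.β) * D.transMat h g}
  one_mem' := by simp
  mul_mem' := by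
    intro g g' hg hg'
    simp only [Set.mem_ofPred_eq, Submonoid.coe_mul, map_mul] at hg hg' ⊢
    rw [mul_assoc, hg', ← mul_assoc, hg, mul_assoc]
  inv_mem' := by
    intro g hg
    simp only [Set.mem_ofPred_eq] at hg ⊢
    have h1 : D.transMat h (g⁻¹ : D.G r) * D.transMat h g = 1 := by
      rw [← map_mul, ← Submonoid.coe_mul, inv_mul_cancel, Submonoid.coe_one, map_one]
    have h2 : D.transMat h g * D.transMat h (g⁻¹ : D.G r) = 1 := by
      rw [← map_mul, ← Submonoid.coe_mul, mul_inv_cancel, Submonoid.coe_one, map_one]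
    calc D.transMat h (g⁻¹ : D.G r) * D.redMat m (D.mat D.β)
        = D.transMat h (g⁻¹ : D.G r) *
            (D.redMat m (D.mat D.β) * D.transMat h g) * D.transMat h (g⁻¹ : D.G r) := by
          rw [mul_assoc, mul_assoc, h2, mul_one]
      _ = D.redMat m (D.mat D.β) * D.transMat h (g⁻¹ : D.G r) := by
          rw [← hg, ← mul_assoc, h1, one_mul]

/-- The centralizer `G_β(O_F / 𝔭_F^r)` of `β` in `G(O_F / 𝔭_F^r)`. -/
abbrev Gβ (r : ℕ) : Subgroup (D.G r) := D.stab (le_refl r)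

/-- With `r = l + l'` and `l` minimal such that `0 < l' ≤ l`, one has `l' = ⌊r/2⌋` and
`l = ⌈r/2⌉`. This is the subgroup `G(O_F / 𝔭_F^r; β)` of the `g` with
`Ad(g) β ≡ β` modulo `𝔭_F^{l'}`. -/
abbrev Gstab (r : ℕ) : Subgroup (D.G r) := D.stab (Nat.div_le_self r 2)

/-- The congruence subgroup `K_{l'}(O_F / 𝔭_F^r)`, `l' = ⌊r/2⌋`. -/
abbrev Kl' (r : ℕ) : Subgroup (D.G r) := D.congrSubgroup (Nat.div_le_self r 2)

/-! ### The characters `θ` -/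

/-- `x ≡ y` modulo `𝔭_K^{e m} = ϖ_F^m O_K`, for `x, y ∈ K`. -/
def CongrK (m : ℕ) (x y : K) : Prop :=
  ∃ z : IntExt p F K, x - y = algebraMap F K ((D.varpi : F) ^ m) * (z : K)

/-- The value `ψ(ϖ_F^{-m} x)` as a complex number. -/
def ψdiv (m : ℕ) (x : F) : ℂ := (D.ψ (((D.varpi : F) ^ m)⁻¹ * x) : ℂ)

/-- The conditions on the unitary character `θ` of `U_{K/K₊}`: it factors through
`(O_K / 𝔭_K^{er})ˣ` (so it is continuous), and `θ(α) = ψ(ϖ_F^{-l'} T_{K/F}(x β))` for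
`α ≡ 1 + ϖ_F^l x` modulo `𝔭_K^{er}` with `x ∈ O_K`, `T_{K/K₊}(x) ≡ 0` modulo `𝔭_{K₊}^{e₊ l'}`. -/
structure IsAdmissible (r : ℕ) (θ : NormOne p F Kp K →* Circle) : Prop where
  factors : ∀ ε : NormOne p F Kp K, D.CongrK r ((ε : (IntExt p F K)ˣ) : IntExt p F K) 1 → θ ε = 1
  eq_ψ : ∀ (α : NormOne p F Kp K) (x : IntExt p F K),
    D.CongrK r ((α : (IntExt p F K)ˣ) : IntExt p F K)
      (1 + algebraMap F K ((D.varpi : F) ^ ((r + 1) / 2)) * (x : K)) →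
    (∃ y : IntExt p F Kp,
      Algebra.trace Kp K (x : K) = algebraMap F Kp ((D.varpi : F) ^ (r / 2)) * (y : Kp)) →
    (θ α : ℂ) = D.ψdiv (r / 2) (Algebra.trace F K ((x : K) * (D.β : K)))

/-- `h ∈ G(O_F / 𝔭_F^r)` is the image of `ε ∈ U_{K/K₊}`. -/
def IsImage {r : ℕ} (h : D.G r) (ε : NormOne p F Kp K) : Prop :=
  (h : Mat n (D.R r)) = D.redMat r (D.mat ((ε : (IntExt p F K)ˣ) : IntExt p F K))

/-- `B(X, β) = tr(X β)`, as an element of `F`. -/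
def Bβ (X : Mat n (IntF p F)) : F := (Matrix.trace (X * D.mat D.β) : IntF p F)

/-! ### The representation `σ_{β,θ}` for even `r` -/

/-- For `r = 2l` even: `σ` is the one-dimensional representation `σ_{β,θ}` of
`G(O_F / 𝔭_F^r; β) = G_β(O_F / 𝔭_F^r) K_l(O_F / 𝔭_F^r)`, given by
`σ(h k) = θ(h) χ_β(k)` where `χ_β(1 + ϖ_F^l X) = ψ(ϖ_F^{-l'} B(X, β))`. -/
def IsSigmaEven (r : ℕ) (θ : NormOne p F Kp K →* Circle) (σ : Representation ℂ (D.Gstab r) ℂ) : Prop :=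
  ∀ (s : D.Gstab r) (h k : D.G r) (ε : NormOne p F Kp K) (X : Mat n (IntF p F)),
    (s : D.G r) = h * k → D.IsImage h ε →
    (k : Mat n (D.R r)) = D.redMat r (1 + D.varpi ^ ((r + 1) / 2) • X) →
    ∀ z : ℂ, σ s z = (θ ε : ℂ) * D.ψdiv (r / 2) (D.Bβ X) * z

/-! ### The representation `σ_{β,θ}` for odd `r` -/

/-- The reduction `β` modulo `𝔭_F`. -/
def βbar : Mat n D.Res := D.resMat (D.mat D.β)

/-- The centralizer `𝔤_β(𝔽)` of `β` in `𝔤(𝔽)`. -/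
def gβRes : Submodule D.Res (Mat n D.Res) := lieCentralizer D.βbar

/-- The form `D_β(X, Y) = B([X, Y], β)` on `𝔤(𝔽)`; its radical is `𝔤_β(𝔽)`. -/
def Dβ (X Y : Mat n D.Res) : D.Res := formDβ D.βbar X Y

/-- The character `ψ(ϖ_F^{-1} x)` of the residue field. -/
def ψbar (a : D.Res) : ℂ := D.ψdiv 1 ((Quotient.out a : IntF p F) : F)

/-- Subspaces `W'`, `W` of `𝔤(𝔽)` with `𝔤(𝔽) = W' ⊕ W ⊕ 𝔤_β(𝔽)`, both isotropic for `D_β`.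
This is the same as a complement `V` of `𝔤_β(𝔽)` in `𝔤(𝔽)` together with a polarization
`W' ⊕ W` of the symplectic space `𝔤(𝔽) / 𝔤_β(𝔽)`, transported to `V`. -/
structure IsPolarization (W' W : Submodule D.Res (Mat n D.Res)) : Prop where
  disjoint : Disjoint W' W
  disjoint_gβ : Disjoint (W' ⊔ W) D.gβRes
  sup_eq : W' ⊔ W ⊔ D.gβRes = lieSp n D.Res
  isotropic' : ∀ X ∈ W', ∀ Y ∈ W', D.Dβ X Y = 0
  isotropic : ∀ X ∈ W, ∀ Y ∈ W, D.Dβ X Y = 0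

/-- For `r = 2l - 1` odd: `η` is the representation `σ^{β,θ}` of `K_{l-1}(O_F / 𝔭_F^r)` on the
space of complex functions on `W'`. For `g = 1 + ϖ_F^{l-1} T`, where `T` modulo `𝔭_F` equals
`v + Y` with `v = u + w₀`, `u ∈ W'`, `w₀ ∈ W`, and `Y ∈ 𝔤_β(𝔽)`, one has
`σ^{β,θ}(g) = ψ(ϖ_F^{-l} B(T, β) - 2⁻¹ ϖ_F^{-1} B(T², β)) ρ_θ(Y) σ^β(v, 1)`.
Here `σ^β` is the Schrödinger representation of the Heisenberg group,
`(σ^β(v, 1) f)(w) = ψ(ϖ_F^{-1} (2⁻¹ D_β(u, w₀) + D_β(w, w₀))) f(w + u)`, and `ρ_θ` is the character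
`ρ_θ(x mod 𝔭) = ψ(-ϖ_F^{-l} B(x, β)) θ(1 + ϖ_F^{l-1} x + 2⁻¹ ϖ_F^{2l-2} x² mod 𝔭^r)` of `𝔤_β(𝔽)`,
where `x` runs over `𝔤_β(O_F) = {x ∈ O_K | T_{K/K₊}(x) = 0}`. -/
def IsEta (r : ℕ) (θ : NormOne p F Kp K →* Circle) (W' W : Submodule D.Res (Mat n D.Res))
    (η : Representation ℂ (D.Kl' r) (W' → ℂ)) : Prop :=
  ∀ (g : D.Kl' r) (T : Mat n (IntF p F)) (u : W') (w₀ : W) (x : IntExt p F K) (ε : NormOne p F Kp K),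
    ((g : D.G r) : Mat n (D.R r)) = D.redMat r (1 + D.varpi ^ (r / 2) • T) →
    Algebra.trace Kp K (x : K) = 0 →
    D.resMat T = u.1 + w₀.1 + D.resMat (D.mat x) →
    D.CongrK r ((ε : (IntExt p F K)ˣ) : IntExt p F K)
      (1 + algebraMap F K ((D.varpi : F) ^ (r / 2)) * (x : K)
        + 2⁻¹ * algebraMap F K ((D.varpi : F) ^ (2 * (r / 2))) * (x : K) ^ 2) →
    ∀ (f : W' → ℂ) (w : W'),
      η g f w =
        (D.ψdiv ((r + 1) / 2) (D.Bβ T) * D.ψdiv 1 (-(2⁻¹ * D.Bβ (T ^ 2)))) *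
        (D.ψdiv ((r + 1) / 2) (-D.Bβ (D.mat x)) * (θ ε : ℂ)) *
        (D.ψbar (Ring.inverse 2 * D.Dβ u.1 w₀.1 + D.Dβ w.1 w₀.1) * f (w + u))

/-- For `r = 2l - 1` odd: `σ` is a representation `σ_{β,θ}` of
`G(O_F / 𝔭_F^r; β) = G_β(O_F / 𝔭_F^r) K_{l-1}(O_F / 𝔭_F^r)` on the space of functions on `W'`,
given by `σ(h g) = θ(h) U(h) ∘ σ^{β,θ}(g)`. Here `U` is a representation of
`G_β(O_F / 𝔭_F^r)` on the same space with `σ^{β,θ}(h⁻¹ g h) = U(h)⁻¹ ∘ σ^{β,θ}(g) ∘ U(h)` and with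
`U(h) = 1` for `h` in `K_{l-1}(O_F / 𝔭_F^r)`; it is not unique. -/
def IsSigmaOdd (r : ℕ) (θ : NormOne p F Kp K →* Circle) (W' W : Submodule D.Res (Mat n D.Res))
    (σ : Representation ℂ (D.Gstab r) (W' → ℂ)) : Prop :=
  ∃ (η : Representation ℂ (D.Kl' r) (W' → ℂ)) (U : Representation ℂ (D.Gβ r) (W' → ℂ)),
    D.IsEta r θ W' W η ∧
    (∀ (h : D.Gβ r) (g g' : D.Kl' r), (g' : D.G r) = (h : D.G r)⁻¹ * g * h →
      η g' = U h⁻¹ * η g * U h) ∧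
    (∀ h : D.Gβ r, (h : D.G r) ∈ D.Kl' r → U h = 1) ∧
    ∀ (s : D.Gstab r) (h : D.Gβ r) (g : D.Kl' r) (ε : NormOne p F Kp K),
      (s : D.G r) = h * g → D.IsImage (h : D.G r) ε → σ s = (θ ε : ℂ) • (U h * η g)

/-! ### The representation `δ_{β,θ}` -/

/-- `δ` is (isomorphic to) a representation `δ_{β,θ} = Ind σ_{β,θ}` of `G(O_F / 𝔭_F^r)`, induced
from `G(O_F / 𝔭_F^r; β)`; the induced representation is realized on the functions `f` on
`G(O_F / 𝔭_F^r)` such that `f(s g) = σ_{β,θ}(s) f(g)`, with right translation. -/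
def IsDelta (r : ℕ) (θ : NormOne p F Kp K →* Circle) {V : Type*} [AddCommGroup V] [Module ℂ V]
    (δ : Representation ℂ (D.G r) V) : Prop :=
  (Even r ∧ ∃ σ : Representation ℂ (D.Gstab r) ℂ,
    D.IsSigmaEven r θ σ ∧
    Nonempty (δ.Equiv (Representation.coind (D.Gstab r).subtype σ))) ∨
  (Odd r ∧ ∃ (W' W : Submodule D.Res (Mat n D.Res))
      (σ : Representation ℂ (D.Gstab r) (W' → ℂ)),
    D.IsPolarization W' W ∧ D.IsSigmaOdd r θ W' W σ ∧
    Nonempty (δ.Equiv (Representation.coind (D.Gstab r).subtype σ)))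

end Datum

end TameSymplectic

end

/-! The dimension of an induced representation is the index of the subgroup times the dimension of
the inducing representation, so the theorem is a matter of counting. Write m = ⌊r/2⌋. Since 2 is a
unit, symplectic matrices lift along the surjections O_F/𝔭^(k+1) → O_F/𝔭^k for k ≥ 1, whose kernels
have square zero; hence G(O_F/𝔭^r) → G(O_F/𝔭^m) is onto. The inducing subgroup is the preimage of
the centralizer G_β(O_F/𝔭^m), so its index is |G(O_F/𝔭^m)| / |G_β(O_F/𝔭^m)| (`index_stab`).

The numerator comes from counting hyperbolic bases over a finite local ring
(`card_symplecticGroup`): it is q^(m(2n²+n)) ∏ (1 - q^(-2k)).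

For the denominator, O_K = O_F[β] forces every matrix commuting with β modulo 𝔭^m to be
multiplication by some a + ωb with a, b in S = O_{K₊}/𝔭^m, and this matrix is symplectic exactly
when the norm a² - d b² is 1, where d = ω². So G_β is a conic over S (`card_centralizer`), and |S| =
q^(mn). If K/F is totally ramified, d is not a unit and the conic has 2|S| points
(`card_conic_of_mem`). If K/K₊ is unramified, d is not a square modulo the maximal ideal 𝔪_S, and
there are |S| + |𝔪_S| = |S|(1 + q^(-f₊)) points (`card_conic_of_nonsquare`). This produces the two
final factors.

The inducing representation has dimension 1 for even r. For odd r its dimension is |W'|, where W' is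
half of a polarization of 𝔤(𝔽)/𝔤_β(𝔽), a space of dimension (2n²+n) - n; this gives q^(n²)
(`card_polarization`). The powers of q combine through 2n²m + n²(r mod 2) = n²r. -/

noncomputable section

open Matrix Module

namespace TameSymplectic

/-! ### Counting hyperbolic bases over a finite local ring -/

section SymplecticCount

variable {R : Type*} [CommRing R] {M : Type*} [AddCommGroup M] [Module R M]

/-- The families `u`, `v` form hyperbolic pairs, mutually orthogonal, for `B`. -/
structure IsHyperbolic {n : ℕ} (B : M →ₗ[R] M →ₗ[R] R) (u v : Fin n → M) : Prop where
  uu : ∀ i j, B (u i) (u j) = 0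
  vv : ∀ i j, B (v i) (v j) = 0
  uv : ∀ i j, B (u i) (v j) = if i = j then 1 else 0

/-- The orthogonal complement of a pair of vectors. -/
def pairCompl (B : M →ₗ[R] M →ₗ[R] R) (u v : M) : Submodule R M :=
  LinearMap.ker (B u) ⊓ LinearMap.ker (B v)

theorem mem_pairCompl {B : M →ₗ[R] M →ₗ[R] R} {u v x : M} :
    x ∈ pairCompl B u v ↔ B u x = 0 ∧ B v x = 0 := by
  simp [pairCompl]

theorem alt_swap {B : M →ₗ[R] M →ₗ[R] R} (hB : ∀ x, B x x = 0) (x y : M) : B x y = -B y x := by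
  have := hB (x + y)
  simp only [map_add, LinearMap.add_apply, hB, zero_add, add_zero] at this
  exact eq_neg_of_add_eq_zero_right this

/-- The projection onto the orthogonal complement of a hyperbolic pair. -/
def pairProj {B : M →ₗ[R] M →ₗ[R] R} (hB : ∀ x, B x x = 0) {u v : M} (huv : B u v = 1) :
    M →ₗ[R] pairCompl B u v :=
  LinearMap.codRestrict _ (LinearMap.id + (B v).smulRight u - (B u).smulRight v) fun x => by
    have h := alt_swap hB v u
    rw [huv] at h
    simp [mem_pairCompl, hB, huv, h]

theorem pairProj_coe {B : M →ₗ[R] M →ₗ[R] R} (hB : ∀ x, B x x = 0) {u v : M} (huv : B u v = 1)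
    (x : M) : (pairProj hB huv x : M) = x + B v x • u - B u x • v := rfl

theorem pairProj_subtype {B : M →ₗ[R] M →ₗ[R] R} (hB : ∀ x, B x x = 0) {u v : M}
    (huv : B u v = 1) (x : pairCompl B u v) : pairProj hB huv x = x := by
  obtain ⟨h1, h2⟩ := mem_pairCompl.1 x.2
  ext
  simp [pairProj_coe, h1, h2]

/-- A module with a hyperbolic pair splits off a hyperbolic plane. -/
def pairEquiv {B : M →ₗ[R] M →ₗ[R] R} (hB : ∀ x, B x x = 0) {u v : M} (huv : B u v = 1) :
    M ≃ (R × R) × pairCompl B u v where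
  toFun x := ((B u x, B v x), pairProj hB huv x)
  invFun c := c.2 - c.1.2 • u + c.1.1 • v
  left_inv x := by
    dsimp only
    rw [pairProj_coe]
    abel
  right_inv c := by
    have h := alt_swap hB v u
    rw [huv] at h
    obtain ⟨h1, h2⟩ := mem_pairCompl.1 c.2.2
    have h3 : B u (c.2 - c.1.2 • u + c.1.1 • v) = c.1.1 := by simp [h1, hB, huv]
    have h4 : B v (c.2 - c.1.2 • u + c.1.1 • v) = c.1.2 := by simp [h2, hB, h]
    refine Prod.ext (Prod.ext h3 h4) ?_
    ext
    rw [pairProj_coe, h3, h4]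
    module

/-- The projection along the hyperbolic plane exhibits the complement as a direct summand. -/
theorem pairCompl_projective [Module.Projective R M] {B : M →ₗ[R] M →ₗ[R] R}
    (hB : ∀ x, B x x = 0) {u v : M} (huv : B u v = 1) :
    Module.Projective R (pairCompl B u v) :=
  Module.Projective.of_split (pairCompl B u v).subtype (pairProj hB huv)
    (LinearMap.ext fun x => pairProj_subtype hB huv x)

theorem card_free_eq_pow_finrank [Nontrivial R] [Module.Free R M] [Module.Finite R M] :
    Nat.card M = Nat.card R ^ finrank R M := by
  rw [Nat.card_congr (Module.finBasis R M).equivFun.toEquiv, Nat.card_fun, Nat.card_fin]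

/-- Projective modules over a local ring are free, so the induction can continue inside the
complement. As R is finite, the ranks can be compared through |M| = |R|² · |complement|. -/
theorem finrank_pairCompl [IsLocalRing R] [Finite R] [Module.Free R M] [Module.Finite R M]
    {B : M →ₗ[R] M →ₗ[R] R} (hB : ∀ x, B x x = 0) {u v : M} (huv : B u v = 1) :
    Module.Free R (pairCompl B u v) ∧ Module.Finite R (pairCompl B u v) ∧
      finrank R M = 2 + finrank R (pairCompl B u v) := by
  have : Finite M := Module.finite_of_finite R
  have := pairCompl_projective hB huv
  have hfree : Module.Free R (pairCompl B u v) := Module.free_of_flat_of_isLocalRing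
  have hfin : Module.Finite R (pairCompl B u v) := Module.Finite.of_finite
  refine ⟨hfree, hfin, ?_⟩
  have h := Nat.card_congr (pairEquiv hB huv)
  rw [Nat.card_prod, Nat.card_prod, card_free_eq_pow_finrank (R := R) (M := M),
    card_free_eq_pow_finrank (R := R) (M := pairCompl B u v), ← pow_two, ← pow_add] at h
  exact Nat.pow_right_injective Finite.one_lt_card h

/-- A vector orthogonal to `u` and `v` pairs with `y` as it does with the projection of `y`, so
nondegeneracy passes to the complement. -/
theorem pairCompl_injective {B : M →ₗ[R] M →ₗ[R] R} (hB : ∀ x, B x x = 0)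
    (hinj : ∀ x, (∀ y, B x y = 0) → x = 0) {u v : M} (huv : B u v = 1)
    (x : pairCompl B u v) (hx : ∀ y : pairCompl B u v, B x y = 0) : x = 0 := by
  obtain ⟨h1, h2⟩ := mem_pairCompl.1 x.2
  ext
  refine hinj x fun y => ?_
  have := hx (pairProj hB huv y)
  rwa [pairProj_coe, map_sub, map_add, map_smul, map_smul, alt_swap hB _ u, h1,
    alt_swap hB _ v, h2, neg_zero, smul_zero, smul_zero, add_zero, sub_zero] at this

/-- Splitting off the first hyperbolic pair. -/
def hyperbolicEquiv {B : M →ₗ[R] M →ₗ[R] R} (hB : ∀ x, B x x = 0) (n : ℕ) :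
    {c : (Fin (n + 1) → M) × (Fin (n + 1) → M) // IsHyperbolic B c.1 c.2} ≃
      Σ a : {a : M × M // B a.1 a.2 = 1},
        {c : (Fin n → pairCompl B a.1.1 a.1.2) × (Fin n → pairCompl B a.1.1 a.1.2) //
          IsHyperbolic (B.domRestrict₁₂ (pairCompl B a.1.1 a.1.2) (pairCompl B a.1.1 a.1.2))
            c.1 c.2} where
  toFun c := ⟨⟨(c.1.1 0, c.1.2 0), by simpa using c.2.uv 0 0⟩,
    (fun i => ⟨c.1.1 i.succ, mem_pairCompl.2 ⟨c.2.uu _ _, by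
        rw [alt_swap hB, c.2.uv, if_neg (Fin.succ_ne_zero i), neg_zero]⟩⟩,
      fun i => ⟨c.1.2 i.succ, mem_pairCompl.2 ⟨by
        rw [c.2.uv, if_neg (Fin.succ_ne_zero i).symm], c.2.vv _ _⟩⟩),
    ⟨fun _ _ => c.2.uu _ _, fun _ _ => c.2.vv _ _, fun i j => by
      simpa [LinearMap.domRestrict₁₂_apply] using c.2.uv i.succ j.succ⟩⟩
  invFun c := ⟨(Fin.cons c.1.1.1 fun i => (c.2.1.1 i : M), Fin.cons c.1.1.2 fun i => (c.2.1.2 i : M)),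
    by
      have h1 := fun i => (mem_pairCompl.1 (c.2.1.1 i).2)
      have h2 := fun i => (mem_pairCompl.1 (c.2.1.2 i).2)
      have h3 := fun i j => c.2.2.uu i j
      have h4 := fun i j => c.2.2.vv i j
      have h5 := fun i j => c.2.2.uv i j
      simp only [LinearMap.domRestrict₁₂_apply] at h3 h4 h5
      refine ⟨fun i j => ?_, fun i j => ?_, fun i j => ?_⟩
      · refine Fin.cases ?_ (fun i => ?_) i <;> refine Fin.cases ?_ (fun j => ?_) j
        · simp [hB]
        · simp [h1]
        · simp [alt_swap hB _ c.1.1.1, h1]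
        · simp [h3]
      · refine Fin.cases ?_ (fun i => ?_) i <;> refine Fin.cases ?_ (fun j => ?_) j
        · simp [hB]
        · simp [h2]
        · simp [alt_swap hB _ c.1.1.2, h2]
        · simp [h4]
      · refine Fin.cases ?_ (fun i => ?_) i <;> refine Fin.cases ?_ (fun j => ?_) j
        · simp [c.1.2]
        · simp [h2, (Fin.succ_ne_zero j).symm]
        · simp [alt_swap hB _ c.1.1.2, h1]
        · simp [h5]⟩
  left_inv c := by
    ext i
    · refine Fin.cases ?_ (fun i => ?_) i <;> simp
    · refine Fin.cases ?_ (fun i => ?_) i <;> simp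
  right_inv c := rfl

section

variable [IsLocalRing R] [Finite R] [Module.Free R M] [Module.Finite R M]

/-- A finite free module and its dual have the same number of elements, so an injective map between
them is bijective. -/
theorem bijective_of_injective {B : M →ₗ[R] M →ₗ[R] R} (hinj : ∀ x, (∀ y, B x y = 0) → x = 0) :
    Function.Bijective B := by
  have : Finite M := Module.finite_of_finite R
  have e := ((Module.finBasis R M).constr R (M' := R)).toEquiv
  have : Finite (M →ₗ[R] R) := Finite.of_equiv _ e
  rw [Nat.bijective_iff_injective_and_card]
  refine ⟨(injective_iff_map_eq_zero B).2 fun x hx => hinj x fun y => by simp [hx], ?_⟩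
  rw [← Nat.card_congr e, Nat.card_congr (Module.finBasis R M).equivFun.toEquiv]

/-- Over a local ring `B u` misses the value 1 exactly when its image lies in the maximal ideal,
that is, when all B(u, b_i) do. By duality these values are free coordinates of `u`. -/
theorem card_not_unimodular {B : M →ₗ[R] M →ₗ[R] R} (hinj : ∀ x, (∀ y, B x y = 0) → x = 0) :
    Nat.card {u : M // ¬ ∃ v, B u v = 1} =
      Nat.card (IsLocalRing.maximalIdeal R) ^ finrank R M := by
  let b := Module.finBasis R M
  let E := (LinearEquiv.ofBijective B (bijective_of_injective hinj)).trans (b.constr R).symm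
  have hE : ∀ u i, E u i = B u (b i) := fun u i => by
    simp [E, Basis.constr_symm_apply]
  have key : ∀ u, (¬ ∃ v, B u v = 1) ↔ ∀ i, E u i ∈ IsLocalRing.maximalIdeal R := by
    intro u
    constructor
    · intro h i
      rw [IsLocalRing.mem_maximalIdeal, mem_nonunits_iff, hE]
      rintro ⟨c, hc⟩
      exact h ⟨((c⁻¹ : Rˣ) : R) • b i, by rw [map_smul, ← hc, smul_eq_mul, Units.inv_mul]⟩
    · rintro h ⟨v, hv⟩
      have : B u v ∈ IsLocalRing.maximalIdeal R := by
        rw [← b.sum_repr v, map_sum]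
        refine Ideal.sum_mem _ fun i _ => ?_
        rw [map_smul, ← hE]
        exact Ideal.mul_mem_left _ _ (h i)
      rw [hv] at this
      exact (IsLocalRing.maximalIdeal.isMaximal R).ne_top ((Ideal.eq_top_iff_one _).2 this)
  rw [Nat.card_congr (E.toEquiv.subtypeEquiv (q := fun f => ∀ i, f i ∈ IsLocalRing.maximalIdeal R) key),
    Nat.card_congr (Equiv.subtypePiEquivPi (p := fun _ x => x ∈ IsLocalRing.maximalIdeal R)),
    Nat.card_pi]
  simp

/-- The solutions form a translate of the kernel of the surjective functional `B u`. -/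
theorem card_pairing_eq_one {B : M →ₗ[R] M →ₗ[R] R} {u v₀ : M} (h : B u v₀ = 1) :
    Nat.card {v : M // B u v = 1} = Nat.card R ^ (finrank R M - 1) ∧ 0 < finrank R M := by
  have : Finite M := Module.finite_of_finite R
  have e : {v : M // B u v = 1} ≃ LinearMap.ker (B u) :=
    { toFun := fun v => ⟨v - v₀, by simp [v.2, h]⟩
      invFun := fun w => ⟨w + v₀, by simp [h]⟩
      left_inv := fun v => by simp
      right_inv := fun w => by simp }
  have hs : Function.Surjective (B u) := fun c => ⟨c • v₀, by simp [h]⟩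
  have h1 := Submodule.card_eq_card_quotient_mul_card (LinearMap.ker (B u))
  rw [Nat.card_congr ((B u).quotKerEquivOfSurjective hs).toEquiv,
    card_free_eq_pow_finrank (R := R) (M := M)] at h1
  have hpos : 0 < finrank R M := by
    rw [Nat.pos_iff_ne_zero]
    intro h0
    rw [h0, pow_zero] at h1
    have := Nat.eq_one_of_mul_eq_one_left h1.symm
    exact absurd this (Finite.one_lt_card (α := R)).ne'
  refine ⟨?_, hpos⟩
  rw [Nat.card_congr e]
  refine Nat.eq_of_mul_eq_mul_left (Nat.card_pos (α := R)) ?_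
  rw [mul_comm, mul_comm (Nat.card R), ← pow_succ, Nat.sub_add_cancel hpos, h1, mul_comm]

/-- First choose a unimodular `u`, then a partner `v`; the number of partners does not depend on
`u`. -/
theorem card_hyperbolic_pair {B : M →ₗ[R] M →ₗ[R] R} (hinj : ∀ x, (∀ y, B x y = 0) → x = 0) :
    Nat.card {c : M × M // B c.1 c.2 = 1} =
      (Nat.card R ^ finrank R M - Nat.card (IsLocalRing.maximalIdeal R) ^ finrank R M) *
        Nat.card R ^ (finrank R M - 1) := by
  classical
  have : Finite M := Module.finite_of_finite R
  have := Fintype.ofFinite M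
  let e : {c : M × M // B c.1 c.2 = 1} ≃ Σ u : {u : M // ∃ v, B u v = 1}, {v : M // B u v = 1} :=
    { toFun := fun c => ⟨⟨c.1.1, c.1.2, c.2⟩, c.1.2, c.2⟩
      invFun := fun c => ⟨(c.1, c.2), c.2.2⟩
      left_inv := fun c => rfl
      right_inv := fun c => rfl }
  rw [Nat.card_congr e, Nat.card_sigma, Finset.sum_congr rfl fun u _ =>
    (card_pairing_eq_one u.2.choose_spec).1, Finset.sum_const, smul_eq_mul, Finset.card_univ,
    ← Nat.card_eq_fintype_card]
  congr 1
  rw [← card_free_eq_pow_finrank, ← card_not_unimodular hinj]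
  have h := Nat.card_congr (Equiv.sumCompl fun u : M => ∃ v, B u v = 1)
  rw [Nat.card_sum] at h
  omega

end

/-- The number of hyperbolic bases of a symplectic space over a finite local ring. -/
theorem card_isHyperbolic [IsLocalRing R] [Finite R] (n : ℕ) : ∀ {M : Type*} [AddCommGroup M] [Module R M] [Module.Free R M]
    [Module.Finite R M] {B : M →ₗ[R] M →ₗ[R] R}, (∀ x, B x x = 0) →
    (∀ x, (∀ y, B x y = 0) → x = 0) → finrank R M = 2 * n →
    Nat.card {c : (Fin n → M) × (Fin n → M) // IsHyperbolic B c.1 c.2} =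
      ∏ k ∈ Finset.range n,
        (Nat.card R ^ (2 * (k + 1)) - Nat.card (IsLocalRing.maximalIdeal R) ^ (2 * (k + 1))) *
          Nat.card R ^ (2 * k + 1) := by
  induction n with
  | zero =>
    intro M _ _ _ _ B _ _ _
    rw [Finset.prod_range_zero, Nat.card_eq_one_iff_unique]
    exact ⟨inferInstance, ⟨⟨(fun i => i.elim0, fun i => i.elim0),
      ⟨fun i => i.elim0, fun i => i.elim0, fun i => i.elim0⟩⟩⟩⟩
  | succ n ih =>
    intro M _ _ _ _ B hB hinj hn
    have : Finite M := Module.finite_of_finite R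
    have := Fintype.ofFinite {a : M × M // B a.1 a.2 = 1}
    -- Choose the first hyperbolic pair, then a hyperbolic basis of its complement; the induction
    -- hypothesis makes the second count independent of the pair.
    rw [Nat.card_congr (hyperbolicEquiv hB n), Nat.card_sigma, Finset.sum_congr rfl fun a _ => ?_,
      Finset.sum_const, smul_eq_mul, Finset.card_univ, ← Nat.card_eq_fintype_card,
      card_hyperbolic_pair hinj, Finset.prod_range_succ, mul_comm, hn]
    · rfl
    · obtain ⟨h1, h2, h3⟩ := finrank_pairCompl hB a.2
      exact ih (fun x => hB x) (pairCompl_injective hB hinj a.2) (by omega)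

end SymplecticCount

/-! ### The order of the symplectic group -/

section SymplecticGroup

variable (n : ℕ) (R : Type*) [CommRing R]

/-- The standard symplectic form, with matrix `J`. -/
def stdForm : (Fin n ⊕ Fin n → R) →ₗ[R] (Fin n ⊕ Fin n → R) →ₗ[R] R :=
  Matrix.toLinearMap₂' R (Matrix.J (Fin n) R)

theorem stdForm_apply (x y : Fin n ⊕ Fin n → R) :
    stdForm n R x y = ∑ i, (x (.inr i) * y (.inl i) - x (.inl i) * y (.inr i)) := by
  simp [stdForm, Matrix.toLinearMap₂'_apply', Matrix.J, Matrix.fromBlocks_mulVec, dotProduct,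
    Matrix.neg_mulVec, Finset.sum_sub_distrib]
  abel

theorem mul_J_mul_transpose_apply (A : Mat n R) (i j : Fin n ⊕ Fin n) :
    (A * Matrix.J (Fin n) R * A.transpose) i j = stdForm n R (A i) (A j) := by
  rw [Matrix.mul_assoc, stdForm, Matrix.toLinearMap₂'_apply']
  rfl

/-- Symplectic matrices are the same as hyperbolic bases. -/
def symplecticEquiv : Matrix.symplecticGroup (Fin n) R ≃
    {c : (Fin n → Fin n ⊕ Fin n → R) × (Fin n → Fin n ⊕ Fin n → R) //
      IsHyperbolic (stdForm n R) c.1 c.2} where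
  -- The lower rows serve as `u` and the upper rows as `v`, because J has 1 in its lower left block
  -- and -1 in its upper right one.
  toFun A := ⟨(fun i => A.1 (.inr i), fun i => A.1 (.inl i)), by
    have h := fun i j => congrFun₂ (SymplecticGroup.mem_iff.1 A.2) i j
    simp only [mul_J_mul_transpose_apply] at h
    constructor <;> intro i j <;> simp [h, Matrix.J, Matrix.one_apply]⟩
  invFun c := ⟨Matrix.of (Sum.elim c.1.2 c.1.1), by
    rw [SymplecticGroup.mem_iff]
    ext i j
    rw [mul_J_mul_transpose_apply]
    have hB : ∀ x, stdForm n R x x = 0 := fun x => by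
      rw [stdForm_apply]
      exact Finset.sum_eq_zero fun i _ => by ring
    rcases i with i | i <;> rcases j with j | j
    · exact c.2.vv i j
    · rw [alt_swap hB]
      refine (congrArg _ (c.2.uv j i)).trans ?_
      simp [Matrix.J, Matrix.one_apply, eq_comm]
    · exact (c.2.uv i j).trans (by simp [Matrix.J, Matrix.one_apply])
    · exact c.2.uu i j⟩
  left_inv A := by
    ext i j
    rcases i with i | i <;> rfl
  right_inv c := rfl

/-- The order of `Sp_{2n}` over a finite local ring. -/
theorem card_symplecticGroup [IsLocalRing R] [Finite R] :
    Nat.card (Matrix.symplecticGroup (Fin n) R) =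
      ∏ k ∈ Finset.range n,
        (Nat.card R ^ (2 * (k + 1)) - Nat.card (IsLocalRing.maximalIdeal R) ^ (2 * (k + 1))) *
          Nat.card R ^ (2 * k + 1) := by
  classical
  rw [Nat.card_congr (symplecticEquiv n R)]
  refine card_isHyperbolic n (fun x => ?_) (fun x hx => ?_) (by simp; ring)
  · rw [stdForm_apply]
    exact Finset.sum_eq_zero fun i _ => by ring
  · ext i
    rcases i with i | i
    · simpa [stdForm_apply, Pi.single_apply] using hx (Pi.single (.inr i) 1)
    · simpa [stdForm_apply, Pi.single_apply] using hx (Pi.single (.inl i) 1)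

end SymplecticGroup

/-! ### Lifting symplectic matrices -/

section Lifting

variable {n : ℕ} {R S : Type*} [CommRing R] [CommRing S]

theorem matrix_mul_eq_zero_of_mem {ι : Type*} [Fintype ι] {I : Ideal R}
    (hI : ∀ x ∈ I, ∀ y ∈ I, x * y = 0) {A B : Matrix ι ι R} (hA : ∀ i j, A i j ∈ I)
    (hB : ∀ i j, B i j ∈ I) : A * B = 0 := by
  ext i j
  rw [Matrix.mul_apply]
  exact Finset.sum_eq_zero fun k _ => hI _ (hA i k) _ (hB k j)

/-- Symplectic matrices lift along surjections with square-zero kernel. -/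
theorem exists_symplectic_lift (f : R →+* S) (hf : Function.Surjective f)
    (hker : ∀ x ∈ RingHom.ker f, ∀ y ∈ RingHom.ker f, x * y = 0) (h2 : IsUnit (2 : R))
    {g : Mat n S} (hg : g ∈ Matrix.symplecticGroup (Fin n) S) :
    ∃ g' ∈ Matrix.symplecticGroup (Fin n) R, f.mapMatrix g' = g := by
  obtain ⟨c, hc⟩ := h2.exists_right_inv
  obtain ⟨G, rfl⟩ : ∃ G : Mat n R, f.mapMatrix G = g :=
    ⟨fun i j => Function.surjInv hf (g i j), by ext i j; exact Function.surjInv_eq hf _⟩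
  set J := Matrix.J (Fin n) R with hJ
  have hJJ : J * J = -1 := Matrix.J_squared _ _
  have hJt : J.transpose = -J := Matrix.J_transpose _ _
  -- The defect of an arbitrary lift `G`: it is antisymmetric, with entries in the square-zero
  -- kernel.
  set E := G * J * G.transpose - J with hE
  have hEk : ∀ i j, E i j ∈ RingHom.ker f := fun i j => by
    have h := congrFun₂ (SymplecticGroup.mem_iff.1 hg) i j
    have h3 : f.mapMatrix E = 0 := by
      rw [SymplecticGroup.mem_iff, ← Matrix.map_J _ f] at hg
      rw [hE, map_sub, map_mul, map_mul, sub_eq_zero]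
      simpa [hJ, RingHom.mapMatrix_apply, Matrix.transpose_map] using hg
    exact congrFun₂ h3 i j
  have hEt : E.transpose = -E := by
    simp only [hE, Matrix.transpose_sub, Matrix.transpose_mul, Matrix.transpose_transpose, hJt]
    simp [Matrix.mul_assoc, sub_eq_neg_add, add_comm]
  have hGE : G * J * G.transpose = J + E := by simp [hE]
  have hmul : ∀ (A B : Mat n R), (∀ i j, A i j ∈ RingHom.ker f) →
      ∀ i j, (A * B) i j ∈ RingHom.ker f := fun A B hA i j => by
    rw [Matrix.mul_apply]
    exact Ideal.sum_mem _ fun k _ => Ideal.mul_mem_right _ _ (hA i k)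
  -- With c = 1/2 one gets XJ + JXᵗ = -E, so multiplying by 1 + X cancels the defect; all remaining
  -- terms are products of two matrices over the kernel.
  set X := c • (E * J) with hX
  have hXk : ∀ i j, X i j ∈ RingHom.ker f := fun i j =>
    Ideal.mul_mem_left _ _ (hmul _ _ hEk i j)
  have hXtk : ∀ i j, X.transpose i j ∈ RingHom.ker f := fun i j => hXk j i
  have hXJ : X * J = -(c • E) := by
    rw [hX, Matrix.smul_mul, Matrix.mul_assoc, hJJ]; simp
  have hJX : J * X.transpose = -(c • E) := by
    rw [hX, Matrix.transpose_smul, Matrix.transpose_mul, hEt, hJt, Matrix.mul_smul, neg_mul_neg,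
      ← Matrix.mul_assoc, hJJ]
    simp
  have hcc : c • E + c • E = E := by
    rw [← add_smul, ← two_mul, hc, one_smul]
  refine ⟨(1 + X) * G, ?_, ?_⟩
  · rw [SymplecticGroup.mem_iff]
    have hz1 : X * E = 0 := matrix_mul_eq_zero_of_mem hker hXk hEk
    have hz2 : E * X.transpose = 0 := matrix_mul_eq_zero_of_mem hker hEk hXtk
    have hz3 : X * J * X.transpose = 0 :=
      matrix_mul_eq_zero_of_mem hker (hmul _ _ hXk) hXtk
    calc (1 + X) * G * J * ((1 + X) * G).transpose
        = (1 + X) * (G * J * G.transpose) * (1 + X.transpose) := by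
          simp only [Matrix.transpose_mul, Matrix.transpose_add, Matrix.transpose_one,
            Matrix.mul_assoc]
      _ = J + E + X * J + J * X.transpose + X * E + E * X.transpose + X * J * X.transpose +
            X * E * X.transpose := by rw [hGE]; noncomm_ring
      _ = J + (E - (c • E + c • E)) := by
          rw [hz1, hz2, hz3, hXJ, hJX, Matrix.zero_mul]; abel
      _ = J := by rw [hcc, sub_self, add_zero]
  · have : f.mapMatrix X = 0 := by ext i j; exact hXk i j
    rw [map_mul, map_add, this, map_one, add_zero, one_mul]

end Lifting

/-! ### Counting points on the conic a² - d b² = 1 over a finite local ring -/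

section Conic

variable {S : Type*} [CommRing S] [IsLocalRing S]

open IsLocalRing

theorem isUnit_of_sub_mem {a b : S} (ha : IsUnit a) (h : b - a ∈ maximalIdeal S) : IsUnit b := by
  by_contra hb
  have : a ∈ maximalIdeal S := by
    have := Ideal.sub_mem _ ((mem_maximalIdeal _).2 hb) h
    simpa using this
  exact (mem_maximalIdeal _).1 this ha

/-- The form is anisotropic modulo the maximal ideal: if b is a unit, dividing by b² reduces the
claim to `hd`. -/
theorem isUnit_norm_iff {d : S} (hd : ∀ c : S, IsUnit (c ^ 2 - d)) (a b : S) :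
    IsUnit (a ^ 2 - d * b ^ 2) ↔ IsUnit a ∨ IsUnit b := by
  constructor
  · intro h
    by_contra! hab
    refine (mem_maximalIdeal _).1 ?_ h
    exact Ideal.sub_mem _ (Ideal.pow_mem_of_mem _ hab.1 2 two_pos)
      (Ideal.mul_mem_left _ _ (Ideal.pow_mem_of_mem _ hab.2 2 two_pos))
  · intro h
    by_cases hb : IsUnit b
    · obtain ⟨u, rfl⟩ := hb
      have := (hd (a * (u⁻¹ : Sˣ))).mul (u.isUnit.pow 2)
      convert this using 1
      have h1 : ((u⁻¹ : Sˣ) : S) * u = 1 := u.inv_mul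
      linear_combination (- a ^ 2 * ((u⁻¹ : Sˣ) : S) * u - a ^ 2) * h1
    · refine isUnit_of_sub_mem ((h.resolve_right hb).pow 2) ?_
      have := Ideal.mul_mem_left _ (-d) (Ideal.pow_mem_of_mem _ ((mem_maximalIdeal _).2 hb) 2 two_pos)
      convert this using 1; ring

variable [Finite S]

/-- Finiteness replaces Hensel's lemma: since 2 is a unit, y ↦ 2y + y² = (1 + y)² - 1 is injective
on the finite maximal ideal, hence surjective. -/
theorem exists_sq_eq_one_add (h2 : IsUnit (2 : S)) {x : S} (hx : x ∈ maximalIdeal S) :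
    ∃ s : S, IsUnit s ∧ s ^ 2 = 1 + x := by
  let f : maximalIdeal S → maximalIdeal S := fun y => ⟨2 * y + y ^ 2,
    Ideal.add_mem _ (Ideal.mul_mem_left _ _ y.2) (Ideal.pow_mem_of_mem _ y.2 2 two_pos)⟩
  have hf : Function.Injective f := by
    intro y z h
    have h1 : ((y : S) - z) * (2 + y + z) = 0 := by
      have := congrArg Subtype.val h
      simp only [f] at this
      linear_combination this
    have h3 : IsUnit (2 + (y : S) + z) := isUnit_of_sub_mem h2 (by
      have := Ideal.add_mem _ y.2 z.2
      convert this using 1; ring)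
    exact Subtype.ext (sub_eq_zero.1 ((h3.mul_left_eq_zero).1 h1))
  obtain ⟨y, hy⟩ := (Finite.injective_iff_surjective.1 hf) ⟨x, hx⟩
  have := congrArg Subtype.val hy
  simp only [f] at this
  exact ⟨1 + y, isUnit_of_sub_mem isUnit_one (by simp), by linear_combination this⟩

/-- If a² = s², then (a - s)(a + s) = 0, and one of the two factors is a unit because they differ by
the unit 2s. -/
theorem card_sq_eq (h2 : IsUnit (2 : S)) {x : S} (hx : x ∈ maximalIdeal S) :
    Nat.card {a : S // a ^ 2 = 1 + x} = 2 := by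
  obtain ⟨s, hs, hsx⟩ := exists_sq_eq_one_add h2 hx
  have key : {a : S | a ^ 2 = 1 + x} = {s, -s} := by
    ext a
    simp only [Set.mem_ofPred_eq, Set.mem_insert_iff, Set.mem_singleton_iff]
    constructor
    · intro ha
      have h0 : (a - s) * (a + s) = 0 := by linear_combination ha - hsx
      have h3 : IsUnit (a - s) ∨ IsUnit (a + s) := by
        by_contra! h
        have h4 := Ideal.sub_mem _ ((mem_maximalIdeal _).2 h.2) ((mem_maximalIdeal _).2 h.1)
        have h5 : (a + s) - (a - s) = 2 * s := by ring
        rw [h5] at h4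
        exact (mem_maximalIdeal _).1 h4 (h2.mul hs)
      rcases h3 with h3 | h3
      · exact Or.inr (eq_neg_of_add_eq_zero_left (h3.mul_right_eq_zero.1 h0))
      · exact Or.inl (sub_eq_zero.1 (h3.mul_left_eq_zero.1 h0))
    · rintro (rfl | rfl)
      · exact hsx
      · rw [neg_sq, hsx]
  have hne : s ≠ -s := fun h => by
    have : 2 * s = 0 := by linear_combination h
    exact not_isUnit_zero (this ▸ h2.mul hs)
  change Nat.card {a : S | a ^ 2 = 1 + x} = 2
  rw [key, Nat.card_coe_set_eq, Set.ncard_pair hne]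

/-- The number of points of a degenerate conic. -/
theorem card_conic_of_mem (h2 : IsUnit (2 : S)) {d : S} (hd : d ∈ maximalIdeal S) :
    Nat.card {c : S × S // c.1 ^ 2 - d * c.2 ^ 2 = 1} = 2 * Nat.card S := by
  have := Fintype.ofFinite S
  -- Fibre over b: each 1 + d b² is congruent to 1 and so has exactly two square roots.
  let e : {c : S × S // c.1 ^ 2 - d * c.2 ^ 2 = 1} ≃ Σ b : S, {a : S // a ^ 2 = 1 + d * b ^ 2} :=
    { toFun := fun c => ⟨c.1.2, c.1.1, by linear_combination c.2⟩
      invFun := fun c => ⟨(c.2, c.1), by linear_combination c.2.2⟩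
      left_inv := fun c => rfl
      right_inv := fun c => rfl }
  rw [Nat.card_congr e, Nat.card_sigma,
    Finset.sum_congr rfl fun b _ => card_sq_eq h2 (Ideal.mul_mem_right (b ^ 2) _ hd)]
  simp [mul_comm]

theorem natCard_units (M : Type*) [Monoid M] : Nat.card Mˣ = Nat.card {x : M // IsUnit x} :=
  Nat.card_congr (Submonoid.unitsTypeEquivIsUnitSubmonoid (M := M)).toEquiv

theorem card_units_local : Nat.card Sˣ + Nat.card (maximalIdeal S) = Nat.card S := by
  classical
  have h := Nat.card_congr (Equiv.sumCompl fun u : S => IsUnit u)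
  rw [Nat.card_sum] at h
  rw [← h, natCard_units]
  rfl

/-- Over the finite residue field of odd characteristic a nondegenerate binary quadratic form
represents every element; the lifted solution is then corrected by the square root of an element
congruent to 1. -/
theorem exists_norm_eq (h2 : IsUnit (2 : S)) {d : S} (hd : IsUnit d) {c : S} (hc : IsUnit c) :
    ∃ a b : S, a ^ 2 - d * b ^ 2 = c := by
  have : Finite (ResidueField S) := Finite.of_surjective _ residue_surjective
  have := Fintype.ofFinite (ResidueField S)
  have hchar : ringChar (ResidueField S) ≠ 2 := by
    intro h
    have h3 := ringChar.Nat.cast_ringChar (R := ResidueField S)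
    rw [h] at h3
    have h4 := h2.map (residue S)
    rw [map_ofNat] at h4
    exact h4.ne_zero (by exact_mod_cast h3)
  open Polynomial in
  obtain ⟨a, b, hab⟩ := FiniteField.exists_root_sum_quadratic
    (f := (X ^ 2 - C (residue S c) : (ResidueField S)[X])) (g := C (-residue S d) * X ^ 2)
    (degree_X_pow_sub_C two_pos _)
    (degree_C_mul_X_pow 2 (neg_ne_zero.2 (hd.map (residue S)).ne_zero))
    (FiniteField.odd_card_of_char_ne_two hchar)
  obtain ⟨a, rfl⟩ := residue_surjective a
  obtain ⟨b, rfl⟩ := residue_surjective b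
  simp only [Polynomial.eval_sub, Polynomial.eval_pow, Polynomial.eval_X, Polynomial.eval_C,
    Polynomial.eval_mul] at hab
  have hm : a ^ 2 - d * b ^ 2 - c ∈ maximalIdeal S := by
    rw [← residue_eq_zero_iff, map_sub, map_sub, map_mul, map_pow, map_pow]
    linear_combination hab
  obtain ⟨u, rfl⟩ := hc
  -- Here s² = u⁻¹(a² - d b²), so scaling a and b by s⁻¹ makes the value exactly u.
  obtain ⟨s, ⟨s, rfl⟩, hs⟩ := exists_sq_eq_one_add h2 (Ideal.mul_mem_left _ ((u⁻¹ : Sˣ) : S) hm)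
  refine ⟨a * (s⁻¹ : Sˣ), b * (s⁻¹ : Sˣ), ?_⟩
  have h1 : ((u⁻¹ : Sˣ) : S) * u = 1 := u.inv_mul
  have h3 : ((s⁻¹ : Sˣ) : S) * s = 1 := s.inv_mul
  have h4 : a ^ 2 - d * b ^ 2 = u * (s : S) ^ 2 := by
    rw [hs]
    linear_combination -(a ^ 2 - d * b ^ 2 - u) * h1
  calc _ = (a ^ 2 - d * b ^ 2) * ((s⁻¹ : Sˣ) : S) ^ 2 := by ring
    _ = u := by
      rw [h4]
      linear_combination (u : S) * (((s⁻¹ : Sˣ) : S) * s + 1) * h3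

/-- The number of points of an anisotropic conic. -/
theorem card_conic_of_nonsquare (h2 : IsUnit (2 : S)) {d : S} (hd : ∀ c : S, IsUnit (c ^ 2 - d)) :
    Nat.card {c : S × S // c.1 ^ 2 - d * c.2 ^ 2 = 1} =
      Nat.card S + Nat.card (maximalIdeal S) := by
  classical
  let Q := QuadraticAlgebra S d 0
  have : Finite Q := Finite.of_equiv _ (QuadraticAlgebra.equivProd d 0).symm
  have hnorm : ∀ z : Q, QuadraticAlgebra.norm z = z.re ^ 2 - d * z.im ^ 2 := fun z => by
    rw [QuadraticAlgebra.norm_def]; ring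
  -- The conic is the kernel of the norm on the units of S[√d], and the norm is onto, so it has |Qˣ|
  -- / |Sˣ| points.
  let φ : Qˣ →* Sˣ := Units.map QuadraticAlgebra.norm
  have hdu : IsUnit d := by simpa using hd 0
  have hφ : Function.Surjective φ := by
    intro c
    obtain ⟨a, b, hab⟩ := exists_norm_eq h2 hdu c.isUnit
    have hn : QuadraticAlgebra.norm (⟨a, b⟩ : Q) = c := by rw [hnorm, ← hab]
    have hz : IsUnit (⟨a, b⟩ : Q) :=
      QuadraticAlgebra.isUnit_iff_norm_isUnit.2 (by rw [hn]; exact c.isUnit)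
    exact ⟨hz.unit, Units.ext hn⟩
  have h1 : Nat.card φ.ker * Nat.card Sˣ = Nat.card Qˣ := by
    rw [← Subgroup.card_mul_index φ.ker, Subgroup.index_ker, MonoidHom.range_eq_top.2 hφ,
      Subgroup.card_top]
  let e : {c : S × S // c.1 ^ 2 - d * c.2 ^ 2 = 1} ≃ φ.ker :=
    { toFun := fun c => ⟨(show IsUnit (⟨c.1.1, c.1.2⟩ : Q) from QuadraticAlgebra.isUnit_iff_norm_isUnit.2
          (by rw [hnorm, c.2]; exact isUnit_one)).unit, by
            rw [MonoidHom.mem_ker]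
            ext
            exact (hnorm _).trans c.2⟩
      invFun := fun z => ⟨((z : Qˣ).1.re, (z : Qˣ).1.im), by
        have := congrArg Units.val (MonoidHom.mem_ker.1 z.2)
        rw [← hnorm]
        exact this⟩
      left_inv := fun c => rfl
      right_inv := fun z => by ext <;> rfl }
  rw [Nat.card_congr e]
  -- By anisotropy the nonunits of Q are the pairs with both coordinates in 𝔪. Thus |Qˣ| = |S|² -
  -- |𝔪|², and dividing by |Sˣ| = |S| - |𝔪| leaves |S| + |𝔪|.
  have hQ : Nat.card Qˣ + Nat.card (maximalIdeal S) ^ 2 = Nat.card S ^ 2 := by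
    have hp := Nat.card_congr (Equiv.sumCompl fun c : S × S => IsUnit c.1 ∨ IsUnit c.2)
    rw [Nat.card_sum, Nat.card_prod, ← pow_two] at hp
    rw [← hp, natCard_units]
    congr 1
    · refine Nat.card_congr ((QuadraticAlgebra.equivProd d 0).subtypeEquiv fun z => ?_)
      rw [QuadraticAlgebra.isUnit_iff_norm_isUnit, hnorm, isUnit_norm_iff hd]
      rfl
    · rw [pow_two, ← Nat.card_prod]
      refine Nat.card_congr
        { toFun := fun c => ⟨(c.1, c.2), not_or.2 ⟨c.1.2, c.2.2⟩⟩
          invFun := fun c => (⟨c.1.1, (not_or.1 c.2).1⟩, ⟨c.1.2, (not_or.1 c.2).2⟩)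
          left_inv := fun c => rfl
          right_inv := fun c => rfl }
  have hS := card_units_local (S := S)
  refine Nat.eq_of_mul_eq_mul_right (Nat.card_pos (α := Sˣ)) ?_
  rw [h1]
  zify at *
  linear_combination hQ - (Nat.card S + Nat.card (maximalIdeal S) : ℤ) * hS

end Conic

/-! ### Dimension of a coinduced representation -/

section Coinduction

variable {k G A : Type*} [Field k] [Group G] [AddCommGroup A] [Module k A]

/-- The factor of `g` in `H` with respect to representatives of the right cosets. -/
def cosetFactor (H : Subgroup G) (g : G) : H :=
  ⟨g * (Quotient.out (Quotient.mk (QuotientGroup.rightRel H) g))⁻¹,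
    QuotientGroup.rightRel_apply.1 (Quotient.mk_out (s := QuotientGroup.rightRel H) g)⟩

theorem mk_mul_rightRel (H : Subgroup G) (h : H) (g : G) :
    Quotient.mk (QuotientGroup.rightRel H) (h * g) = Quotient.mk _ g :=
  Quotient.sound (QuotientGroup.rightRel_apply.2 (by simp))

theorem cosetFactor_mul (H : Subgroup G) (h : H) (g : G) :
    cosetFactor H (h * g) = h * cosetFactor H g := by
  ext
  simp only [cosetFactor, Subgroup.coe_mul]
  rw [mk_mul_rightRel, mul_assoc]

theorem cosetFactor_out (H : Subgroup G) (c : Quotient (QuotientGroup.rightRel H)) :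
    cosetFactor H c.out = 1 := by
  ext
  simp [cosetFactor]

theorem cosetFactor_mul_out (H : Subgroup G) (g : G) :
    (cosetFactor H g : G) * (Quotient.mk (QuotientGroup.rightRel H) g).out = g := by
  simp [cosetFactor]

/-- A coinduced representation is determined by its values on representatives. -/
def coindEquiv (H : Subgroup G) (σ : Representation k H A) :
    Representation.coindV H.subtype σ ≃ₗ[k] (Quotient (QuotientGroup.rightRel H) → A) where
  toFun f c := f.1 c.out
  map_add' _ _ := rfl
  map_smul' _ _ := rfl
  invFun f := ⟨fun g => σ (cosetFactor H g) (f (Quotient.mk _ g)), fun h g => by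
    simp only [Subgroup.subtype_apply]
    rw [cosetFactor_mul, mk_mul_rightRel, map_mul, Module.End.mul_apply]⟩
  left_inv f := by
    ext g
    refine (f.2 (cosetFactor H g) _).symm.trans ?_
    rw [Subgroup.subtype_apply, cosetFactor_mul_out]
  right_inv f := by
    ext c
    simp only [cosetFactor_out, map_one, Module.End.one_apply, Quotient.out_eq]

theorem finrank_coind [Finite G] [FiniteDimensional k A] (H : Subgroup G)
    (σ : Representation k H A) :
    finrank k (Representation.coindV H.subtype σ) = H.index * finrank k A := by
  have := Fintype.ofFinite (Quotient (QuotientGroup.rightRel H))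
  rw [(coindEquiv H σ).finrank_eq, Module.finrank_pi_fintype, Finset.sum_const, smul_eq_mul,
    Finset.card_univ, ← Nat.card_eq_fintype_card,
    Nat.card_congr (QuotientGroup.quotientRightRelEquivQuotientLeftRel H)]
  rfl

end Coinduction

/-! ### The symplectic Lie algebra and its trace form -/

section LieAlgebra

variable {n : ℕ} {A : Type*} [CommRing A]

theorem mem_lieSp {X : Mat n A} :
    X ∈ lieSp n A ↔ X * Matrix.J (Fin n) A + Matrix.J (Fin n) A * X.transpose = 0 := Iff.rfl

theorem mem_lieSp_iff {X : Mat n A} :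
    X ∈ lieSp n A ↔ (X * Matrix.J (Fin n) A).transpose = X * Matrix.J (Fin n) A := by
  rw [mem_lieSp, Matrix.transpose_mul, Matrix.J_transpose, Matrix.neg_mul, neg_eq_iff_add_eq_zero,
    add_comm]

theorem mul_J_mul_J (X : Mat n A) : X * Matrix.J (Fin n) A * Matrix.J (Fin n) A = -X := by
  rw [Matrix.mul_assoc, Matrix.J_squared, Matrix.mul_neg, Matrix.mul_one]

/-- The symplectic Lie algebra is isomorphic to the space of symmetric matrices. -/
def lieSpEquiv : lieSp n A ≃ (Sym2 (Fin n ⊕ Fin n) → A) where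
  toFun X := Sym2.lift ⟨fun i j => (X.1 * Matrix.J (Fin n) A) i j, fun i j =>
    congrFun₂ (mem_lieSp_iff.1 X.2) j i⟩
  invFun f := ⟨-(Matrix.of (fun i j => f s(i, j)) * Matrix.J (Fin n) A), by
    rw [mem_lieSp_iff, Matrix.neg_mul, mul_J_mul_J, neg_neg]
    ext i j
    simp [Sym2.eq_swap]⟩
  left_inv X := by
    ext1
    change -((X.1 * Matrix.J (Fin n) A) * Matrix.J (Fin n) A) = X.1
    rw [mul_J_mul_J, neg_neg]
  right_inv f := by
    ext z
    induction z using Sym2.ind with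
    | _ i j =>
      simp only [Sym2.lift_mk, Matrix.neg_mul, mul_J_mul_J, neg_neg]
      rfl

/-- X ↦ XJ identifies the Lie algebra with symmetric matrices of size 2n, which have n(2n+1) free
entries. -/
theorem card_lieSp : Nat.card (lieSp n A) = Nat.card A ^ (2 * n ^ 2 + n) := by
  rw [Nat.card_congr lieSpEquiv, Nat.card_fun, Nat.card_eq_fintype_card (α := Sym2 _), Sym2.card]
  congr 1
  rw [Fintype.card_sum, Fintype.card_fin, Nat.choose_two_right]
  apply Nat.div_eq_of_eq_mul_left two_pos
  rw [Nat.add_sub_cancel]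
  ring

/-- The trace form is nondegenerate on the symplectic Lie algebra. -/
theorem eq_zero_of_trace_mul_eq_zero (h2 : IsUnit (2 : A)) {Z : Mat n A} (hZ : Z ∈ lieSp n A)
    (h : ∀ Y ∈ lieSp n A, Matrix.trace (Y * Z) = 0) : Z = 0 := by
  rw [Matrix.ext_iff_trace_mul_left]
  intro X
  set J := Matrix.J (Fin n) A with hJ
  have hJJ : J * J = -1 := Matrix.J_squared _ _
  have hJt : J.transpose = -J := Matrix.J_transpose _ _
  -- Symmetrizing an arbitrary X gives an element of the Lie algebra whose trace pairing with Z is 2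
  -- tr(XZ); so Z is orthogonal to all matrices.
  have hY : X + J * X.transpose * J ∈ lieSp n A := by
    rw [mem_lieSp, ← hJ]
    simp only [Matrix.transpose_add, Matrix.transpose_mul, Matrix.transpose_transpose, hJt,
      add_mul, mul_add, Matrix.mul_assoc, hJJ, Matrix.neg_mul, Matrix.mul_neg]
    simp only [← Matrix.mul_assoc, hJJ]
    simp only [Matrix.neg_mul, Matrix.one_mul, Matrix.mul_one]
    abel
  have hJZ : J * Z * J = Z.transpose := by
    have := congrArg (fun M => J * M) (mem_lieSp.1 hZ)
    simp only [← hJ, mul_add, ← Matrix.mul_assoc, hJJ, Matrix.mul_zero] at this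
    rw [Matrix.neg_mul, Matrix.one_mul] at this
    exact add_neg_eq_zero.1 this
  have h1 := h _ hY
  have h3 : Matrix.trace (J * X.transpose * J * Z) = Matrix.trace (X * Z) := by
    rw [Matrix.mul_assoc, Matrix.mul_assoc, Matrix.trace_mul_comm, Matrix.mul_assoc, hJZ,
      ← Matrix.transpose_mul, Matrix.trace_transpose, Matrix.trace_mul_comm]
  rw [Matrix.add_mul, Matrix.trace_add, h3, ← two_mul] at h1
  rw [Matrix.mul_zero, Matrix.trace_zero]
  exact h2.mul_right_eq_zero.1 h1

/-- Cyclicity of the trace moves the commutator onto β, which turns the radical of D_β into a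
centralizer. -/
theorem formDβ_eq (β X Y : Mat n A) :
    formDβ β X Y = Matrix.trace (Y * (β * X - X * β)) := by
  rw [formDβ, Matrix.sub_mul, Matrix.mul_sub, Matrix.trace_sub, Matrix.trace_sub,
    Matrix.mul_assoc, Matrix.trace_mul_comm, Matrix.mul_assoc, Matrix.mul_assoc]

theorem commutator_mem_lieSp {X Y : Mat n A} (hX : X ∈ lieSp n A) (hY : Y ∈ lieSp n A) :
    X * Y - Y * X ∈ lieSp n A := by
  rw [mem_lieSp] at *
  set J := Matrix.J (Fin n) A with hJ
  have h1 : X * J = -(J * X.transpose) := eq_neg_of_add_eq_zero_left hX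
  have h2 : Y * J = -(J * Y.transpose) := eq_neg_of_add_eq_zero_left hY
  simp only [Matrix.transpose_sub, Matrix.transpose_mul, sub_mul, mul_sub, Matrix.mul_assoc, h1,
    h2, mul_neg]
  simp only [← Matrix.mul_assoc, h1, h2]
  simp only [Matrix.mul_assoc, neg_mul, neg_neg]
  abel

end LieAlgebra

/-! ### Rings of integers in finite extensions of ℚ_p -/

section LocalField

variable {p : ℕ} [Fact p.Prime]

theorem charZero_of_padic (p : ℕ) [Fact p.Prime] (F : Type*) [Field F] [Algebra ℚ_[p] F] :
    CharZero F :=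
  charZero_of_injective_algebraMap (algebraMap ℚ_[p] F).injective

/-- Both sides say that the minimal polynomial over ℚ_p has coefficients in ℤ_p; for integrality
this uses that ℤ_p is integrally closed. -/
theorem isIntegral_iff_spectralNorm_le_one {L : Type*} [Field L] [Algebra ℚ_[p] L]
    [Algebra.IsAlgebraic ℚ_[p] L] [Algebra ℤ_[p] L] [IsScalarTower ℤ_[p] ℚ_[p] L] (x : L) :
    IsIntegral ℤ_[p] x ↔ spectralNorm ℚ_[p] L x ≤ 1 := by
  have hx : IsIntegral ℚ_[p] x := Algebra.IsIntegral.isIntegral x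
  rw [spectralNorm, spectralValue_le_one_iff (minpoly.monic hx)]
  constructor
  · intro h k
    rw [minpoly.isIntegrallyClosed_eq_field_fractions' ℚ_[p] h, Polynomial.coeff_map]
    exact PadicInt.norm_le_one _
  · intro h
    have hl : minpoly ℚ_[p] x ∈ Polynomial.lifts (algebraMap ℤ_[p] ℚ_[p]) := by
      rw [Polynomial.lifts_iff_coeff_lifts]
      exact fun k => ⟨⟨_, h k⟩, rfl⟩
    obtain ⟨P, hP, -, hm⟩ := Polynomial.lifts_and_degree_eq_and_monic hl (minpoly.monic hx)
    refine ⟨P, hm, ?_⟩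
    rw [IsScalarTower.algebraMap_eq ℤ_[p] ℚ_[p] L, ← Polynomial.eval₂_map, hP]
    exact minpoly.aeval _ _

/-- In a finite extension of `ℚ_p`, if a sum of two integral elements is `1`, then one of them is
a unit. -/
theorem isIntegral_inv_or {L : Type*} [Field L] [Algebra ℚ_[p] L]
    [Algebra.IsAlgebraic ℚ_[p] L] [Algebra ℤ_[p] L] [IsScalarTower ℤ_[p] ℚ_[p] L] {a b : L}
    (h : a + b = 1) (ha : IsIntegral ℤ_[p] a) (hb : IsIntegral ℤ_[p] b) :
    (a ≠ 0 ∧ IsIntegral ℤ_[p] a⁻¹) ∨ (b ≠ 0 ∧ IsIntegral ℤ_[p] b⁻¹) := by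
  have key : ∀ c : L, spectralNorm ℚ_[p] L c = 1 → c ≠ 0 ∧ IsIntegral ℤ_[p] c⁻¹ := by
    intro c hc
    have hc0 : c ≠ 0 := by
      rintro rfl
      rw [spectralNorm_zero] at hc
      exact zero_ne_one hc
    refine ⟨hc0, (isIntegral_iff_spectralNorm_le_one _).2 ?_⟩
    have h1 := spectralAlgNorm_mul (K := ℚ_[p]) c c⁻¹
    rw [mul_inv_cancel₀ hc0, spectralAlgNorm_one, spectralAlgNorm_def, spectralAlgNorm_def, hc,
      one_mul] at h1
    exact h1.symm.le
  rw [isIntegral_iff_spectralNorm_le_one] at ha hb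
  -- Since 1 = |a + b| ≤ max(|a|, |b|), one of the two has norm 1, and multiplicativity makes its
  -- inverse integral.
  have h1 := isNonarchimedean_spectralNorm (K := ℚ_[p]) (L := L) a b
  rw [h, spectralNorm_one, le_max_iff] at h1
  exact h1.imp (fun h1 => key a (le_antisymm ha h1)) (fun h1 => key b (le_antisymm hb h1))

theorem isUnit_two_padicInt (hp : p ≠ 2) : IsUnit (2 : ℤ_[p]) := by
  rw [PadicInt.isUnit_iff]
  have h : ¬ (p : ℤ) ∣ 2 := fun h => by
    have := (Nat.prime_dvd_prime_iff_eq (Fact.out : p.Prime) Nat.prime_two).1 (by exact_mod_cast h)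
    exact hp this
  have h1 := PadicInt.norm_le_one (2 : ℤ_[p])
  refine le_antisymm h1 (not_lt.1 fun h2 => h ?_)
  rw [← PadicInt.norm_int_lt_one_iff_dvd]
  exact_mod_cast h2

theorem isUnit_two_intF {F : Type*} [Field F] [Algebra ℤ_[p] F] (hp : p ≠ 2) : IsUnit (2 : IntF p F) := by
  have h := (isUnit_two_padicInt hp).map (algebraMap ℤ_[p] (IntF p F))
  rwa [map_ofNat] at h

variable {F : Type*} [Field F] [Algebra ℚ_[p] F] [FiniteDimensional ℚ_[p] F]
  [Algebra ℤ_[p] F] [IsScalarTower ℤ_[p] ℚ_[p] F]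

theorem isLocalRing_intF : IsLocalRing (IntF p F) := by
  refine { isUnit_or_isUnit_of_add_one := fun {a b} h => ?_ }
  have h1 : (a : F) + b = 1 := by exact_mod_cast congrArg Subtype.val h
  refine (isIntegral_inv_or h1 a.2 b.2).imp ?_ ?_
  · rintro ⟨h2, h3⟩
    exact IsUnit.of_mul_eq_one ⟨_, h3⟩ (Subtype.ext (mul_inv_cancel₀ h2))
  · rintro ⟨h2, h3⟩
    exact IsUnit.of_mul_eq_one ⟨_, h3⟩ (Subtype.ext (mul_inv_cancel₀ h2))

theorem isLocalRing_intExt {L : Type*} [Field L] [Algebra F L] [FiniteDimensional F L] :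
    IsLocalRing (IntExt p F L) := by
  -- L is viewed as a finite extension of ℚ_p, where integrality over O_F and over ℤ_p agree by
  -- transitivity.
  let _ : Algebra ℚ_[p] L := ((algebraMap F L).comp (algebraMap ℚ_[p] F)).toAlgebra
  have : IsScalarTower ℚ_[p] F L := IsScalarTower.of_algebraMap_eq fun _ => rfl
  let _ : Algebra ℤ_[p] L := ((algebraMap F L).comp (algebraMap ℤ_[p] F)).toAlgebra
  have : IsScalarTower ℤ_[p] F L := IsScalarTower.of_algebraMap_eq fun _ => rfl
  have : IsScalarTower ℤ_[p] ℚ_[p] L := IsScalarTower.of_algebraMap_eq fun x => by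
    rw [IsScalarTower.algebraMap_apply ℤ_[p] F L, IsScalarTower.algebraMap_apply ℤ_[p] ℚ_[p] F,
      IsScalarTower.algebraMap_apply ℚ_[p] F L]
  have : FiniteDimensional ℚ_[p] L := FiniteDimensional.trans ℚ_[p] F L
  have : IsScalarTower ℤ_[p] (IntF p F) L := IsScalarTower.of_algebraMap_eq fun x => by
    rw [IsScalarTower.algebraMap_apply ℤ_[p] F L]; rfl
  have hiff : ∀ x : L, IsIntegral (IntF p F) x ↔ IsIntegral ℤ_[p] x := fun x =>
    ⟨fun h => isIntegral_trans x h, fun h => h.tower_top⟩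
  refine { isUnit_or_isUnit_of_add_one := fun {a b} h => ?_ }
  have h1 : (a : L) + b = 1 := by exact_mod_cast congrArg Subtype.val h
  refine (isIntegral_inv_or h1 ((hiff _).1 a.2) ((hiff _).1 b.2)).imp ?_ ?_
  · rintro ⟨h2, h3⟩
    exact IsUnit.of_mul_eq_one ⟨_, (hiff _).2 h3⟩ (Subtype.ext (mul_inv_cancel₀ h2))
  · rintro ⟨h2, h3⟩
    exact IsUnit.of_mul_eq_one ⟨_, (hiff _).2 h3⟩ (Subtype.ext (mul_inv_cancel₀ h2))

theorem isFractionRing_intF : IsFractionRing (IntF p F) F :=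
  integralClosure.isFractionRing_of_finite_extension ℚ_[p] F

theorem isDedekindDomain_intF : IsDedekindDomain (IntF p F) :=
  have := charZero_of_padic p F
  integralClosure.isDedekindDomain ℤ_[p] ℚ_[p] F

theorem finite_intF : Module.Finite ℤ_[p] (IntF p F) :=
  have := charZero_of_padic p F
  IsIntegralClosure.finite ℤ_[p] ℚ_[p] F (IntF p F)

theorem isDedekindDomain_intExt {L : Type*} [Field L] [Algebra F L] [FiniteDimensional F L] :
    IsDedekindDomain (IntExt p F L) :=
  have := charZero_of_padic p F
  have := isDedekindDomain_intF (p := p) (F := F)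
  have := isFractionRing_intF (p := p) (F := F)
  integralClosure.isDedekindDomain (IntF p F) F L

theorem finite_intExt {L : Type*} [Field L] [Algebra F L] [FiniteDimensional F L] :
    Module.Finite (IntF p F) (IntExt p F L) :=
  have := charZero_of_padic p F
  have := isDedekindDomain_intF (p := p) (F := F)
  have := isFractionRing_intF (p := p) (F := F)
  IsIntegralClosure.finite (IntF p F) F L (IntExt p F L)

theorem under_eq_maximalIdeal {A B : Type*} [CommRing A] [IsLocalRing A] [CommRing B] [Algebra A B]
    [Algebra.IsIntegral A B] (P : Ideal B) [P.IsMaximal] : P.under A = IsLocalRing.maximalIdeal A :=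
  IsLocalRing.eq_maximalIdeal (Ideal.IsMaximal.under A P)

/-- The residue field of `F` is finite. -/
theorem finite_quotient_intF (P : Ideal (IntF p F)) [P.IsMaximal] : Finite (IntF p F ⧸ P) := by
  have := finite_intF (p := p) (F := F)
  have h : Finite (ℤ_[p] ⧸ P.under ℤ_[p]) := by
    rw [under_eq_maximalIdeal]
    exact inferInstanceAs (Finite (IsLocalRing.ResidueField ℤ_[p]))
  exact Module.finite_of_finite (ℤ_[p] ⧸ P.under ℤ_[p])

/-- Every maximal ideal lies over (p), and p is nonzero in F. -/
theorem ne_bot_of_isMaximal_intF (P : Ideal (IntF p F)) [hP : P.IsMaximal] : P ≠ ⊥ := by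
  rintro rfl
  have := finite_intF (p := p) (F := F)
  have h := under_eq_maximalIdeal (A := ℤ_[p]) (⊥ : Ideal (IntF p F))
  have h1 : (p : ℤ_[p]) ∈ (⊥ : Ideal (IntF p F)).under ℤ_[p] := by
    rw [h, PadicInt.maximalIdeal_eq_span_p]
    exact Ideal.mem_span_singleton_self _
  rw [Ideal.mem_under, Ideal.mem_bot, map_natCast] at h1
  have := charZero_of_padic p F
  have h2 : (p : F) = 0 := by exact_mod_cast congrArg (algebraMap (IntF p F) F) h1
  exact (Fact.out : p.Prime).ne_zero (by exact_mod_cast h2)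

theorem card_quotient_pow {A : Type*} [CommRing A] [IsDedekindDomain A] (P : Ideal A) [P.IsPrime]
    (hP : P ≠ ⊥) (m : ℕ) : Nat.card (A ⧸ P ^ m) = Nat.card (A ⧸ P) ^ m :=
  cardQuot_pow_of_prime hP

/-- The local rings A and A/I have the same residue field. -/
theorem card_quotient_local {A : Type*} [CommRing A] [IsLocalRing A] (I : Ideal A)
    [IsLocalRing (A ⧸ I)] :
    Nat.card (A ⧸ I) = Nat.card (A ⧸ IsLocalRing.maximalIdeal A) *
      Nat.card (IsLocalRing.maximalIdeal (A ⧸ I)) := by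
  rw [Submodule.card_eq_card_quotient_mul_card (IsLocalRing.maximalIdeal (A ⧸ I)), mul_comm]
  congr 1
  have hs : Function.Surjective ((Ideal.Quotient.mk (IsLocalRing.maximalIdeal (A ⧸ I))).comp
    (Ideal.Quotient.mk I)) := Ideal.Quotient.mk_surjective.comp Ideal.Quotient.mk_surjective
  have hk : RingHom.ker ((Ideal.Quotient.mk (IsLocalRing.maximalIdeal (A ⧸ I))).comp
      (Ideal.Quotient.mk I)) = IsLocalRing.maximalIdeal A :=
    let _ := Ideal.Quotient.field (IsLocalRing.maximalIdeal (A ⧸ I))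
    IsLocalRing.eq_maximalIdeal (RingHom.ker_isMaximal_of_surjective _ hs)
  rw [← hk]
  exact (Nat.card_congr (RingHom.quotientKerEquivOfSurjective hs).toEquiv).symm

end LocalField

/-! ### Algebras with involution: centralizers as multiplications -/

/-- A free algebra `A` with an involution, a decomposition `A = P ⊕ ω P` under which the involution
is `ω ↦ -ω`, an antiinvariant generator `β`, and a basis in which the involution is the adjoint
for the standard symplectic form. -/
structure InvolutiveAlgebra (O P A : Type*) [CommRing O] [CommRing P] [CommRing A] [Algebra O P]
    [Algebra O A] (n : ℕ) where
  isUnit_two : IsUnit (2 : O)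
  incl : P →ₐ[O] A
  tau : A →ₐ[O] A
  ω : A
  d : P
  β : A
  tau_incl : ∀ a, tau (incl a) = incl a
  tau_ω : tau ω = -ω
  sq_ω : ω ^ 2 = incl d
  comps : P × P ≃+ A
  comps_apply : ∀ c, comps c = incl c.1 + ω * incl c.2
  adjoin_β : Algebra.adjoin O {β} = ⊤
  b : Basis (Fin n ⊕ Fin n) O A
  mat_mul_J' : ∀ a, (Algebra.leftMulMatrix b a)ᵀ * Matrix.J (Fin n) O =
    Matrix.J (Fin n) O * Algebra.leftMulMatrix b (tau a)

namespace InvolutiveAlgebra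

variable {O P A : Type*} [CommRing O] [CommRing P] [CommRing A] [Algebra O P] [Algebra O A] {n : ℕ}
  (D : InvolutiveAlgebra O P A n)

theorem tau_decomp (a b : P) :
    D.tau (D.comps (a, b)) = D.incl a - D.ω * D.incl b := by
  rw [comps_apply, map_add, map_mul, tau_incl, tau_incl, tau_ω]
  ring

/-- Components in P ⊕ ωP are unique, so divisibility by an element of P can be tested on each of
them. -/
theorem incl_dvd_comps {c a b : P} : D.incl c ∣ D.comps (a, b) ↔ c ∣ a ∧ c ∣ b := by
  constructor
  · rintro ⟨y, hy⟩
    obtain ⟨⟨a', b'⟩, rfl⟩ := D.comps.surjective y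
    have h : D.comps (a, b) = D.comps (c * a', c * b') := by
      rw [hy, comps_apply, comps_apply, map_mul, map_mul]; ring
    have h1 := D.comps.injective h
    exact ⟨⟨a', congrArg Prod.fst h1⟩, ⟨b', congrArg Prod.snd h1⟩⟩
  · rintro ⟨⟨a', rfl⟩, ⟨b', rfl⟩⟩
    exact ⟨D.comps (a', b'), by rw [comps_apply, comps_apply, map_mul, map_mul]; ring⟩

theorem algebraMap_dvd_comps {c : O} {a b : P} :
    algebraMap O A c ∣ D.comps (a, b) ↔ algebraMap O P c ∣ a ∧ algebraMap O P c ∣ b := by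
  rw [← D.incl.commutes, incl_dvd_comps]

theorem algebraMap_dvd_incl {c : O} {a : P} :
    algebraMap O A c ∣ D.incl a ↔ algebraMap O P c ∣ a := by
  have := D.algebraMap_dvd_comps (c := c) (a := a) (b := 0)
  rw [comps_apply, map_zero, mul_zero, add_zero] at this
  rw [this]
  simp

theorem tau_mul_comps (a b : P) :
    D.tau (D.comps (a, b)) * D.comps (a, b) = D.incl (a ^ 2 - D.d * b ^ 2) := by
  rw [tau_decomp, comps_apply, map_sub, map_mul, map_pow, map_pow, ← sq_ω]
  ring

/-- The matrix of multiplication by `a`, acting on row vectors. -/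
def mat (a : A) : Mat n O := (Algebra.leftMulMatrix D.b a)ᵀ

theorem mat_mul_J (a : A) :
    D.mat a * Matrix.J (Fin n) O = Matrix.J (Fin n) O * (D.mat (D.tau a))ᵀ := D.mat_mul_J' a

/-! ### Matrices modulo `c` -/

/-- Reduction of matrices modulo `c`. -/
def red (c : O) : Mat n O →+* Mat n (O ⧸ Ideal.span {c}) :=
  (Ideal.Quotient.mk (Ideal.span {c})).mapMatrix

theorem red_eq_zero {c : O} {X : Mat n O} : red c X = 0 ↔ ∀ i j, c ∣ X i j := by
  rw [← Matrix.ext_iff]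
  refine forall_congr' fun i => forall_congr' fun j => ?_
  rw [← Ideal.mem_span_singleton]
  exact Ideal.Quotient.eq_zero_iff_mem

theorem red_surjective (c : O) : Function.Surjective (red (n := n) c) := fun X =>
  ⟨fun i j => (X i j).out, by ext i j; exact Ideal.Quotient.mk_out _⟩

theorem red_transpose (c : O) (X : Mat n O) : red c Xᵀ = (red c X)ᵀ := rfl

theorem red_J (c : O) : red c (Matrix.J (Fin n) _) = Matrix.J (Fin n) _ :=
  Matrix.map_J _ _

theorem dvd_iff_repr {c : O} {x : A} :
    algebraMap O A c ∣ x ↔ ∀ j, c ∣ D.b.repr x j := by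
  constructor
  · rintro ⟨y, rfl⟩ j
    rw [← Algebra.smul_def, map_smul, Finsupp.smul_apply, smul_eq_mul]
    exact dvd_mul_right _ _
  · intro h
    rw [← D.b.sum_repr x]
    refine Finset.dvd_sum fun j _ => ?_
    obtain ⟨y, hy⟩ := h j
    rw [hy, mul_smul, Algebra.smul_def]
    exact dvd_mul_right _ _

theorem forall_dvd_iff_toMatrix {c : O} {φ : A →ₗ[O] A} :
    (∀ x, algebraMap O A c ∣ φ x) ↔
      ∀ i j, c ∣ LinearMap.toMatrix D.b D.b φ i j := by
  constructor
  · intro h i j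
    rw [LinearMap.toMatrix_apply]
    exact D.dvd_iff_repr.1 (h _) i
  · intro h x
    rw [← D.b.sum_repr x, map_sum]
    refine Finset.dvd_sum fun j _ => ?_
    rw [map_smul, Algebra.smul_def]
    refine Dvd.dvd.mul_left (D.dvd_iff_repr.2 fun i => ?_) _
    rw [← LinearMap.toMatrix_apply]
    exact h i j

theorem mat_mul (x y : A) : D.mat (x * y) = D.mat x * D.mat y := by
  rw [mul_comm, mat, map_mul, Matrix.transpose_mul]; rfl

theorem mat_add (x y : A) : D.mat (x + y) = D.mat x + D.mat y := by
  rw [mat, map_add, Matrix.transpose_add]; rfl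

theorem mat_sub (x y : A) : D.mat (x - y) = D.mat x - D.mat y := by
  rw [mat, map_sub, Matrix.transpose_sub]; rfl

theorem mat_one : D.mat 1 = 1 := by
  rw [mat, map_one, Matrix.transpose_one]

theorem mat_transpose (a : A) :
    (D.mat a)ᵀ = LinearMap.toMatrix D.b D.b (LinearMap.mulLeft O a) := rfl

theorem red_mat_eq_zero {c : O} {a : A} :
    red c (D.mat a) = 0 ↔ algebraMap O A c ∣ a := by
  rw [red_eq_zero]
  have h : (∀ i j, c ∣ D.mat a i j) ↔
      ∀ i j, c ∣ LinearMap.toMatrix D.b D.b (LinearMap.mulLeft O a) i j := by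
    rw [← mat_transpose, forall_comm]; rfl
  rw [h, ← D.forall_dvd_iff_toMatrix]
  constructor
  · intro h; simpa using h 1
  · intro h x; exact h.mul_right _

theorem red_mat_eq_iff {c : O} {a a' : A} :
    red c (D.mat a) = red c (D.mat a') ↔ algebraMap O A c ∣ a - a' := by
  rw [← D.red_mat_eq_zero, mat_sub, map_sub, sub_eq_zero]

/-- The centralizer of `β` modulo `c` consists of the multiplications by elements of `A`. -/
theorem exists_eq_red_mat {c : O} {g : Mat n (O ⧸ Ideal.span {c})}
    (hg : g * red c (D.mat D.β) = red c (D.mat D.β) * g) : ∃ a, g = red c (D.mat a) := by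
  obtain ⟨G, rfl⟩ := red_surjective c g
  let φ : A →ₗ[O] A := Matrix.toLin D.b D.b Gᵀ
  have hφ : LinearMap.toMatrix D.b D.b φ = Gᵀ := LinearMap.toMatrix_toLin _ _ _
  have hβ : ∀ x, algebraMap O A c ∣ D.β * φ x - φ (D.β * x) := by
    have h : ∀ i j, c ∣ LinearMap.toMatrix D.b D.b
        (LinearMap.mulLeft O D.β ∘ₗ φ - φ ∘ₗ LinearMap.mulLeft O D.β) i j := by
      intro i j
      rw [map_sub, LinearMap.toMatrix_comp D.b D.b D.b, LinearMap.toMatrix_comp D.b D.b D.b, hφ,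
        ← mat_transpose, ← Matrix.transpose_mul, ← Matrix.transpose_mul]
      have : red c (G * D.mat D.β - D.mat D.β * G) = 0 := by
        rw [map_sub, map_mul, map_mul, hg, sub_self]
      exact red_eq_zero.1 this j i
    exact D.forall_dvd_iff_toMatrix.2 h
  -- Commuting with β modulo c propagates to O[β] = A, so φ is A-linear modulo c and hence is
  -- multiplication by φ(1).
  have hall : ∀ a x, algebraMap O A c ∣ a * φ x - φ (a * x) := by
    intro a
    have ha : a ∈ Algebra.adjoin O {D.β} := by rw [D.adjoin_β]; trivial
    induction ha using Algebra.adjoin_induction with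
    | mem a ha =>
      rw [Set.mem_singleton_iff] at ha
      subst ha
      exact hβ
    | algebraMap r =>
      intro x
      rw [← Algebra.smul_def, ← Algebra.smul_def, map_smul, sub_self]
      exact dvd_zero _
    | add a b _ _ h1 h2 =>
      intro x
      have : (a + b) * φ x - φ ((a + b) * x) = (a * φ x - φ (a * x)) + (b * φ x - φ (b * x)) := by
        rw [add_mul a b x, map_add]; ring
      rw [this]
      exact dvd_add (h1 x) (h2 x)
    | mul a b _ _ h1 h2 =>
      intro x
      have : (a * b) * φ x - φ ((a * b) * x) =
          a * (b * φ x - φ (b * x)) + (a * φ (b * x) - φ (a * (b * x))) := by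
        rw [mul_assoc a b x]; ring
      rw [this]
      exact dvd_add ((h2 x).mul_left _) (h1 _)
  refine ⟨φ 1, ?_⟩
  rw [← sub_eq_zero, ← map_sub, red_eq_zero]
  intro i j
  have h : ∀ x, algebraMap O A c ∣
      (φ - LinearMap.mulLeft O (φ 1)) x := fun x => by
    have := hall x 1
    rw [mul_one] at this
    rw [LinearMap.sub_apply, LinearMap.mulLeft_apply, mul_comm (φ 1), ← neg_sub]
    exact (dvd_neg).2 this
  have := D.forall_dvd_iff_toMatrix.1 h j i
  rw [map_sub, hφ, ← mat_transpose] at this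
  exact this

/-- As τ is the adjoint involution for J, the product mat(a) J mat(a)ᵗ equals J mat(τ(a)a)ᵗ, and J
is invertible. -/
theorem red_mat_mem_symplecticGroup {c : O} {a : A} :
    red c (D.mat a) ∈ Matrix.symplecticGroup (Fin n) (O ⧸ Ideal.span {c}) ↔
      algebraMap O A c ∣ D.tau a * a - 1 := by
  have h : red c (D.mat a) * Matrix.J (Fin n) _ * (red c (D.mat a))ᵀ =
      Matrix.J (Fin n) _ * (red c (D.mat (D.tau a * a)))ᵀ := by
    rw [← red_J, ← red_transpose, ← red_transpose, ← map_mul, ← map_mul, ← map_mul, mat_mul_J,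
      Matrix.mul_assoc, ← Matrix.transpose_mul, ← mat_mul, mul_comm a]
  rw [SymplecticGroup.mem_iff, h, ← D.red_mat_eq_iff, mat_one, map_one]
  constructor
  · intro h1
    have h2 := congrArg (fun X => -Matrix.J (Fin n) _ * X) h1
    simp only [← Matrix.mul_assoc, Matrix.neg_mul, Matrix.J_squared, neg_neg, Matrix.one_mul] at h2
    rw [← Matrix.transpose_transpose (red c _), h2, Matrix.transpose_one]
  · intro h1
    rw [h1, Matrix.transpose_one, Matrix.mul_one]

/-- The additive analogue: the defining expression equals J mat(τ(a) + a)ᵗ. -/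
theorem red_mat_mem_lieSp {c : O} {a : A} :
    red c (D.mat a) ∈ lieSp n (O ⧸ Ideal.span {c}) ↔
      algebraMap O A c ∣ D.tau a + a := by
  have h : red c (D.mat a) * Matrix.J (Fin n) _ + Matrix.J (Fin n) _ * (red c (D.mat a))ᵀ =
      Matrix.J (Fin n) _ * (red c (D.mat (D.tau a + a)))ᵀ := by
    rw [← red_J, ← red_transpose, ← red_transpose, ← map_mul, ← map_mul, ← map_mul, mat_mul_J,
      mat_add, Matrix.transpose_add, Matrix.mul_add, map_add]
  rw [mem_lieSp, h, ← D.red_mat_eq_zero]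
  constructor
  · intro h1
    have h2 := congrArg (fun X => -Matrix.J (Fin n) _ * X) h1
    simp only [← Matrix.mul_assoc, Matrix.neg_mul, Matrix.J_squared, neg_neg, Matrix.one_mul,
      Matrix.mul_zero] at h2
    rw [← Matrix.transpose_transpose (red c _), h2, Matrix.transpose_zero]
  · intro h1
    rw [h1, Matrix.transpose_zero, Matrix.mul_zero]

theorem red_mat_comm (c : O) (a b : A) :
    red c (D.mat a) * red c (D.mat b) = red c (D.mat b) * red c (D.mat a) := by
  rw [← map_mul, ← map_mul, ← mat_mul, ← mat_mul, mul_comm]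

/-! ### Cardinalities -/

/-- The ring `P / c`. -/
abbrev QuotP {O : Type*} (P : Type*) [CommRing O] [CommRing P] [Algebra O P] (c : O) : Type _ :=
  P ⧸ Ideal.span {algebraMap O P c}

theorem mk_eq_iff_dvd {A : Type*} [CommRing A] {c x y : A} :
    Ideal.Quotient.mk (Ideal.span {c}) x = Ideal.Quotient.mk (Ideal.span {c}) y ↔ c ∣ x - y := by
  rw [Ideal.Quotient.mk_eq_mk_iff_sub_mem, Ideal.mem_span_singleton]

theorem card_quotient_eq_of_surjective {B : Type*} [AddCommGroup B] {f : A →+ B}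
    (hf : Function.Surjective f) {c : A} (hc : ∀ x, f x = 0 ↔ c ∣ x) :
    Nat.card (A ⧸ Ideal.span {c}) = Nat.card B := by
  have h : f.ker = (Ideal.span {c}).toAddSubgroup := by
    ext x
    rw [AddMonoidHom.mem_ker, hc, ← Ideal.mem_span_singleton]
    rfl
  have h1 := AddSubgroup.index_ker f
  rw [h, AddMonoidHom.range_eq_top.2 hf, AddSubgroup.card_top] at h1
  exact h1

theorem card_quotA (D : InvolutiveAlgebra O P A n) (c : O) :
    Nat.card (A ⧸ Ideal.span {algebraMap O A c}) = Nat.card (O ⧸ Ideal.span {c}) ^ (2 * n) := by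
  let f : A →+ (Fin n ⊕ Fin n → O ⧸ Ideal.span {c}) :=
    { toFun := fun x i => Ideal.Quotient.mk _ (D.b.repr x i)
      map_zero' := by ext i; simp
      map_add' := fun x y => by ext i; simp }
  have hf : Function.Surjective f := fun y => by
    refine ⟨D.b.equivFun.symm fun i => (y i).out, ?_⟩
    ext i
    change Ideal.Quotient.mk _ (D.b.equivFun (D.b.equivFun.symm _) i) = _
    rw [LinearEquiv.apply_symm_apply]
    exact Ideal.Quotient.mk_out _
  rw [card_quotient_eq_of_surjective hf, Nat.card_fun, Nat.card_sum, Nat.card_fin, two_mul]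
  intro x
  rw [dvd_iff_repr D, funext_iff]
  refine forall_congr' fun i => ?_
  rw [← Ideal.mem_span_singleton]
  exact Ideal.Quotient.eq_zero_iff_mem

/-- No basis of P over O is available; instead A ≅ P × P gives |P/c|² = |A/c| = |O/c|^(2n). -/
theorem card_quotP (D : InvolutiveAlgebra O P A n) (c : O) :
    Nat.card (QuotP P c) = Nat.card (O ⧸ Ideal.span {c}) ^ n := by
  let g : A →+ QuotP P c × QuotP P c :=
    (AddMonoidHom.prodMap (Ideal.Quotient.mk _).toAddMonoidHom
      (Ideal.Quotient.mk _).toAddMonoidHom).comp (D.comps.symm : A →+ P × P)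
  have hgc : ∀ a b, g (D.comps (a, b)) = (Ideal.Quotient.mk _ a, Ideal.Quotient.mk _ b) := by
    intro a b
    change (Ideal.Quotient.mk _ (D.comps.symm (D.comps _)).1,
      Ideal.Quotient.mk _ (D.comps.symm (D.comps _)).2) = _
    rw [AddEquiv.symm_apply_apply]
  have hg : Function.Surjective g := fun y => ⟨D.comps (y.1.out, y.2.out), by
    rw [hgc]
    exact Prod.ext (Ideal.Quotient.mk_out _) (Ideal.Quotient.mk_out _)⟩
  have h := D.card_quotA c
  rw [card_quotient_eq_of_surjective hg, Nat.card_prod, two_mul, pow_add] at h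
  · exact Nat.mul_self_inj.1 h
  intro x
  obtain ⟨⟨a, b⟩, rfl⟩ := D.comps.surjective x
  rw [hgc, algebraMap_dvd_comps, Prod.mk_eq_zero, Ideal.Quotient.eq_zero_iff_mem,
    Ideal.Quotient.eq_zero_iff_mem, Ideal.mem_span_singleton, Ideal.mem_span_singleton]

/-- `G_β` modulo `c` is the group of norm one elements. -/
theorem card_centralizer (c : O) :
    Nat.card {g : Matrix.symplecticGroup (Fin n) (O ⧸ Ideal.span {c}) //
      g * red c (D.mat D.β) = red c (D.mat D.β) * g} =
    Nat.card {s : QuotP P c × QuotP P c //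
      s.1 ^ 2 - Ideal.Quotient.mk _ D.d * s.2 ^ 2 = 1} := by
  -- Being symplectic modulo c is the norm equation modulo c for the components of the multiplier.
  have key : ∀ a b : P,
      (Ideal.Quotient.mk (Ideal.span {algebraMap O P c}) a) ^ 2 -
        Ideal.Quotient.mk _ D.d * (Ideal.Quotient.mk _ b) ^ 2 = 1 ↔
      red c (D.mat (D.comps (a, b))) ∈
        Matrix.symplecticGroup (Fin n) (O ⧸ Ideal.span {c}) := by
    intro a b
    rw [red_mat_mem_symplecticGroup, tau_mul_comps, ← map_one D.incl, ← map_sub,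
      algebraMap_dvd_incl, ← map_pow, ← map_pow, ← map_mul, ← map_sub,
      ← map_one (Ideal.Quotient.mk _), mk_eq_iff_dvd]
  symm
  refine Nat.card_congr (Equiv.ofBijective (fun s => ⟨⟨red c (D.mat (D.comps (s.1.1.out, s.1.2.out))),
    (key _ _).1 (by rw [Ideal.Quotient.mk_out, Ideal.Quotient.mk_out]; exact s.2)⟩,
      D.red_mat_comm c _ _⟩) ⟨?_, ?_⟩)
  · intro s t h
    have h1 : red c (D.mat (D.comps (s.1.1.out, s.1.2.out))) =
      red c (D.mat (D.comps (t.1.1.out, t.1.2.out))) := congrArg (fun g => g.1.1) h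
    rw [red_mat_eq_iff, ← map_sub, algebraMap_dvd_comps] at h1
    simp only [Prod.mk_sub_mk] at h1
    rw [← mk_eq_iff_dvd, ← mk_eq_iff_dvd] at h1
    simp only [Ideal.Quotient.mk_out] at h1
    exact Subtype.ext (Prod.ext h1.1 h1.2)
  · rintro ⟨⟨g, hg⟩, hgβ⟩
    obtain ⟨x, rfl⟩ := D.exists_eq_red_mat hgβ
    obtain ⟨⟨a, b⟩, rfl⟩ := D.comps.surjective x
    refine ⟨⟨(Ideal.Quotient.mk _ a, Ideal.Quotient.mk _ b), (key a b).2 hg⟩, ?_⟩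
    refine Subtype.ext (Subtype.ext ?_)
    rw [red_mat_eq_iff, ← map_sub, algebraMap_dvd_comps]
    simp only [Prod.mk_sub_mk]
    rw [← mk_eq_iff_dvd, ← mk_eq_iff_dvd]
    simp only [Ideal.Quotient.mk_out, and_self]

/-- Elements are multiplications by x = a + ωb with τ(x) + x = 2a ≡ 0; as 2 is a unit, only ωb
survives. -/
theorem card_lieCentralizer (c : O) :
    Nat.card (lieCentralizer (red c (D.mat D.β))) = Nat.card (QuotP P c) := by
  have h2 : IsUnit (2 : P) := by
    have := D.isUnit_two.map (algebraMap O P)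
    rwa [map_ofNat] at this
  have key : ∀ a b : P, red c (D.mat (D.comps (a, b))) ∈ lieSp n (O ⧸ Ideal.span {c}) ↔
      algebraMap O P c ∣ a := by
    intro a b
    have h : D.tau (D.comps (a, b)) + D.comps (a, b) = D.incl (2 * a) := by
      rw [tau_decomp, comps_apply, map_mul, map_ofNat]; ring
    rw [red_mat_mem_lieSp, h, algebraMap_dvd_incl, h2.dvd_mul_left]
  have hcomm : ∀ X : Mat n (O ⧸ Ideal.span {c}), X ∈ lieCentralizer (red c (D.mat D.β)) ↔
      X ∈ lieSp n _ ∧ X * red c (D.mat D.β) = red c (D.mat D.β) * X := by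
    intro X
    rw [lieCentralizer, Submodule.mem_inf, Subalgebra.mem_toSubmodule, Subalgebra.mem_centralizer_iff]
    simp [eq_comm]
  symm
  refine Nat.card_congr (Equiv.ofBijective (fun s => ⟨red c (D.mat (D.comps (0, s.out))),
    (hcomm _).2 ⟨(key _ _).2 (dvd_zero _), D.red_mat_comm c _ _⟩⟩) ⟨?_, ?_⟩)
  · intro s t h
    have h1 : red c (D.mat (D.comps (0, s.out))) =
      red c (D.mat (D.comps (0, t.out))) := congrArg (fun g => g.1) h
    rw [red_mat_eq_iff, ← map_sub, algebraMap_dvd_comps] at h1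
    simp only [Prod.mk_sub_mk] at h1
    rw [← mk_eq_iff_dvd, ← mk_eq_iff_dvd] at h1
    simp only [Ideal.Quotient.mk_out] at h1
    exact h1.2
  · rintro ⟨X, hX⟩
    obtain ⟨hX1, hX2⟩ := (hcomm X).1 hX
    obtain ⟨x, rfl⟩ := D.exists_eq_red_mat hX2
    obtain ⟨⟨a, b⟩, rfl⟩ := D.comps.surjective x
    have ha := (key a b).1 hX1
    refine ⟨Ideal.Quotient.mk _ b, Subtype.ext ?_⟩
    rw [red_mat_eq_iff, ← map_sub, algebraMap_dvd_comps]
    simp only [Prod.mk_sub_mk, zero_sub]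
    refine ⟨(dvd_neg).2 ha, ?_⟩
    rw [← mk_eq_iff_dvd]
    simp only [Ideal.Quotient.mk_out]

end InvolutiveAlgebra

/-! ### Building the involutive algebra from a decomposition and a form -/

namespace InvolutiveAlgebra

variable {O P A : Type*} [CommRing O] [CommRing P] [CommRing A] [Algebra O P] [Algebra O A] {n : ℕ}

/-- Write ω² = a + ωb. It is fixed by τ, so uniqueness of components gives b = -b, hence b = 0. -/
theorem exists_sq_eq (h2 : IsUnit (2 : O)) {incl : P →ₐ[O] A} {tau : A →ₐ[O] A} {ω : A}
    (tau_incl : ∀ a, tau (incl a) = incl a) (tau_ω : tau ω = -ω)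
    (hdec : ∀ x : A, ∃! c : P × P, x = incl c.1 + ω * incl c.2) : ∃ d, ω ^ 2 = incl d := by
  obtain ⟨⟨a, b⟩, h, -⟩ := hdec (ω ^ 2)
  have h1 : incl a - ω * incl b = ω ^ 2 := by
    have := congrArg tau h
    rw [map_pow, map_add, map_mul, tau_incl, tau_incl, tau_ω, neg_sq] at this
    rw [this]; ring
  have hb : (a, b) = (a, -b) := (hdec (ω ^ 2)).unique h (by rw [← h1, map_neg]; ring)
  have h4 : (2 : P) * b = 0 := by linear_combination congrArg Prod.snd hb
  have h5 : IsUnit (2 : P) := by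
    have := h2.map (algebraMap O P)
    rwa [map_ofNat] at this
  exact ⟨a, by rw [h, h5.mul_right_eq_zero.1 h4, map_zero, mul_zero, add_zero]⟩

theorem tau_tau_of_decomp {incl : P →ₐ[O] A} {tau : A →ₐ[O] A} {ω : A}
    (tau_incl : ∀ a, tau (incl a) = incl a) (tau_ω : tau ω = -ω)
    (hdec : ∀ x : A, ∃! c : P × P, x = incl c.1 + ω * incl c.2) (x : A) : tau (tau x) = x := by
  obtain ⟨⟨a, b⟩, rfl, -⟩ := hdec x
  simp only [map_add, map_mul, tau_incl, tau_ω, map_neg, neg_neg]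

/-- Two elements of `P` give an element of `A`. -/
def compsOfDecomp {incl : P →ₐ[O] A} {ω : A}
    (hdec : ∀ x : A, ∃! c : P × P, x = incl c.1 + ω * incl c.2) : P × P ≃+ A :=
  AddEquiv.ofBijective
    (AddMonoidHom.mk' (fun c : P × P => incl c.1 + ω * incl c.2) fun c c' => by
      simp only [Prod.fst_add, Prod.snd_add, map_add]; ring)
    ⟨fun c c' h => (hdec (incl c.1 + ω * incl c.2)).unique rfl h, fun x => by
      obtain ⟨c, hc, -⟩ := hdec x
      exact ⟨c, hc.symm⟩⟩

/-- An involution which is adjoint for a form with matrix `-J` is transposition with respect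
to `J`. -/
theorem mat_mul_J_of_form {F : Type*} [CommRing F] [Algebra O F]
    (hF : Function.Injective (algebraMap O F)) {tau : A →ₐ[O] A} (b : Basis (Fin n ⊕ Fin n) O A)
    (B : A →ₗ[O] A →ₗ[O] F) (hb : ∀ i j, B (b i) (b j) = -algebraMap O F (Matrix.J (Fin n) O i j))
    (hB : ∀ a x y, B (a * x) y = B x (tau a * y)) (a : A) :
    (Algebra.leftMulMatrix b a)ᵀ * Matrix.J (Fin n) O =
    Matrix.J (Fin n) O * Algebra.leftMulMatrix b (tau a) := by
  have hm : ∀ a i, a * b i = ∑ j, Algebra.leftMulMatrix b a j i • b j := fun a i => by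
    simp_rw [Algebra.leftMulMatrix_eq_repr_mul]
    exact (b.sum_repr _).symm
  ext i k
  apply hF
  have h := hB a (b i) (b k)
  rw [hm, hm, map_sum, LinearMap.sum_apply, map_sum] at h
  simp only [map_smul, LinearMap.smul_apply, hb, smul_neg, Finset.sum_neg_distrib, neg_inj] at h
  rw [Matrix.mul_apply, Matrix.mul_apply, map_sum, map_sum]
  simp only [map_mul, Matrix.transpose_apply]
  simp only [Algebra.smul_def] at h
  rw [h]
  exact Finset.sum_congr rfl fun j _ => mul_comm _ _

end InvolutiveAlgebra

/-! ### The ring O_K as an involutive algebra -/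

namespace Datum

variable {p : ℕ} [Fact p.Prime] {F Kp K : Type*} [Field F] [Algebra ℤ_[p] F] [Field Kp]
  [Algebra F Kp] [Field K] [Algebra Kp K] [Algebra F K] [IsScalarTower F Kp K] {n : ℕ}

/-- The inclusion of `O_{K₊}` in `O_K`. -/
def incl (p : ℕ) [Fact p.Prime] (F Kp K : Type*) [Field F] [Algebra ℤ_[p] F] [Field Kp]
    [Algebra F Kp] [Field K] [Algebra Kp K] [Algebra F K] [IsScalarTower F Kp K] :
    IntExt p F Kp →ₐ[IntF p F] IntExt p F K :=
  (IsScalarTower.toAlgHom (IntF p F) Kp K).mapIntegralClosure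

variable (D : Datum p F Kp K n)

/-- The involution `τ` on `O_K`. -/
def tauO : IntExt p F K →ₐ[IntF p F] IntExt p F K :=
  (((D.τ : K →ₐ[Kp] K).restrictScalars F).restrictScalars (IntF p F)).mapIntegralClosure

theorem coe_tauO (x : IntExt p F K) : (D.tauO x : K) = D.τ x := rfl

theorem tauO_incl (a : IntExt p F Kp) : D.tauO (incl p F Kp K a) = incl p F Kp K a :=
  Subtype.ext (D.τ.commutes _)

theorem tauO_ω : D.tauO D.ω = -D.ω := Subtype.ext D.τ_ω

theorem existsUnique_decomp (x : IntExt p F K) : ∃! c : IntExt p F Kp × IntExt p F Kp,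
    x = incl p F Kp K c.1 + D.ω * incl p F Kp K c.2 := by
  obtain ⟨c, hc, hu⟩ := D.decomp_ω x
  exact ⟨c, Subtype.ext hc, fun c' hc' => hu c' (congrArg Subtype.val hc')⟩

/-- The form `D` on `O_K`, as a bilinear form. -/
def bilin : IntExt p F K →ₗ[IntF p F] IntExt p F K →ₗ[IntF p F] F :=
  LinearMap.mk₂ (IntF p F) (fun x y => formD (F := F) D.τ (D.ω : K) (algebraMap Kp K D.varpiP)
    ((Ideal.span {D.varpiP}).ramificationIdx (IntF p F)) x y)
    (fun x y z => by
      simp only [formD, Subalgebra.coe_add, map_add, mul_add, add_mul])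
    (fun c x y => by
      have h : D.τ ((c • x : IntExt p F K) : K) = (c : F) • D.τ x :=
        map_smul (D.τ.restrictScalars F) (c : F) (x : K)
      simp only [formD, h, mul_smul_comm, smul_mul_assoc, map_smul, smul_eq_mul]
      exact mul_left_comm _ _ _)
    (fun x y z => by simp only [formD, Subalgebra.coe_add, map_add, mul_add])
    (fun c x y => by
      have h : ((c • y : IntExt p F K) : K) = (c : F) • (y : K) := rfl
      simp only [formD, h, mul_smul_comm, map_smul, smul_eq_mul]
      exact mul_left_comm _ _ _)

theorem bilin_apply (x y : IntExt p F K) : D.bilin x y = 2⁻¹ * Algebra.trace F K ((D.ω : K)⁻¹ *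
    (algebraMap Kp K D.varpiP) ^ (1 - ((Ideal.span {D.varpiP}).ramificationIdx (IntF p F) : ℤ)) *
      D.τ x * y) := rfl

/-- The trace is τ-invariant, and τ exchanges the roles of x and y while changing the sign of ω⁻¹.
-/
theorem bilin_swap (x y : IntExt p F K) : D.bilin y x = -D.bilin x y := by
  have hττ : ∀ z : IntExt p F K, D.τ (D.τ z) = z := fun z =>
    congrArg Subtype.val (InvolutiveAlgebra.tau_tau_of_decomp D.tauO_incl D.tauO_ω
      D.existsUnique_decomp z)
  have h := Algebra.trace_eq_of_algEquiv (D.τ.restrictScalars F) ((D.ω : K)⁻¹ *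
    (algebraMap Kp K D.varpiP) ^ (1 - ((Ideal.span {D.varpiP}).ramificationIdx (IntF p F) : ℤ)) *
      D.τ x * y)
  rw [bilin_apply, bilin_apply, ← h]
  simp only [AlgEquiv.restrictScalars_apply, map_mul, map_inv₀, map_zpow₀, AlgEquiv.commutes, D.τ_ω,
    hττ, inv_neg, neg_mul, map_neg, mul_neg, neg_neg]
  rw [mul_right_comm]

theorem bilin_mul (a x y : IntExt p F K) : D.bilin (a * x) y = D.bilin x (D.tauO a * y) := by
  rw [bilin_apply, bilin_apply, Subalgebra.coe_mul, Subalgebra.coe_mul, coe_tauO, map_mul D.τ]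
  congr 2
  ring

/-- The sign reflects conventions: D(u_i, v_i) = 1, whereas the upper right block of J is -1. -/
theorem bilin_basis (i j : Fin n ⊕ Fin n) :
    D.bilin (D.b i) (D.b j) = -algebraMap (IntF p F) F (Matrix.J (Fin n) (IntF p F) i j) := by
  rcases i with i | i <;> rcases j with j | j
  · exact (D.form_uu i j).trans (by simp [Matrix.J])
  · refine (D.form_uv i j).trans ?_
    simp only [Matrix.J, Matrix.fromBlocks_apply₁₂, Matrix.neg_apply, Matrix.one_apply]
    split_ifs <;> simp
  · rw [bilin_swap]
    refine (congrArg _ (D.form_uv j i)).trans ?_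
    simp only [Matrix.J, Matrix.fromBlocks_apply₂₁, Matrix.one_apply, eq_comm (a := j)]
    split_ifs <;> simp
  · exact (D.form_vv i j).trans (by simp [Matrix.J])

/-- The involutive algebra `O_K`. -/
def involutive (h2 : IsUnit (2 : IntF p F)) :
    InvolutiveAlgebra (IntF p F) (IntExt p F Kp) (IntExt p F K) n where
  isUnit_two := h2
  incl := incl p F Kp K
  tau := D.tauO
  ω := D.ω
  d := (InvolutiveAlgebra.exists_sq_eq h2 D.tauO_incl D.tauO_ω D.existsUnique_decomp).choose
  β := D.β
  tau_incl := D.tauO_incl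
  tau_ω := D.tauO_ω
  sq_ω := (InvolutiveAlgebra.exists_sq_eq h2 D.tauO_incl D.tauO_ω D.existsUnique_decomp).choose_spec
  comps := InvolutiveAlgebra.compsOfDecomp D.existsUnique_decomp
  comps_apply _ := rfl
  adjoin_β := D.adjoin_β
  b := D.b
  mat_mul_J' := InvolutiveAlgebra.mat_mul_J_of_form Subtype.val_injective D.b D.bilin D.bilin_basis
    D.bilin_mul

end Datum

/-! ### The size of a polarization -/

section Polarization

/-- Isotropic complements of the radical `𝔤_β` have the same size. -/
theorem card_isotropic_le {k M : Type*} [Field k] [Finite k] [AddCommGroup M] [Module k M]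
    [Finite M] (B : M →ₗ[k] M →ₗ[k] k) (W' W : Submodule k M)
    (h : ∀ x ∈ W', (∀ y ∈ W, B x y = 0) → x = 0) : Nat.card W' ≤ Nat.card W := by
  let f : W' →ₗ[k] Module.Dual k W := (LinearMap.lcomp k k W.subtype) ∘ₗ B ∘ₗ W'.subtype
  have hf : Function.Injective f := by
    rw [injective_iff_map_eq_zero]
    intro x hx
    refine Subtype.ext (h x x.2 fun y hy => ?_)
    exact LinearMap.congr_fun hx ⟨y, hy⟩
  have h1 := LinearMap.finrank_le_finrank_of_injective hf
  rw [Subspace.dual_finrank_eq] at h1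
  rw [Module.natCard_eq_pow_finrank (K := k), Module.natCard_eq_pow_finrank (K := k) (V := W)]
  exact Nat.pow_le_pow_right Nat.card_pos h1

theorem card_sup_of_disjoint {k M : Type*} [Ring k] [AddCommGroup M] [Module k M]
    {U V : Submodule k M} (h : Disjoint U V) :
    Nat.card (U ⊔ V : Submodule k M) = Nat.card U * Nat.card V := by
  have hinj : Function.Injective (U.subtype.coprod V.subtype) := by
    rw [← LinearMap.ker_eq_bot, LinearMap.ker_coprod_of_disjoint_range _ _ (by simpa using h)]
    simp
  rw [← Nat.card_prod, Nat.card_congr (LinearEquiv.ofInjective _ hinj).toEquiv,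
    Submodule.sup_eq_range]

/-- The form `D_β` as a bilinear form. -/
def bilinβ {k : Type*} [CommRing k] {n : ℕ} (β : Mat n k) : Mat n k →ₗ[k] Mat n k →ₗ[k] k :=
  LinearMap.mk₂ k (formDβ β)
    (fun X Y Z => by simp only [formDβ, add_mul, mul_add, sub_mul, Matrix.trace_add,
      Matrix.trace_sub]; ring)
    (fun c X Y => by simp only [formDβ, Matrix.smul_mul, Matrix.mul_smul, sub_mul,
      Matrix.trace_smul, Matrix.trace_sub, smul_sub])
    (fun X Y Z => by simp only [formDβ, add_mul, mul_add, sub_mul, Matrix.trace_add,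
      Matrix.trace_sub]; ring)
    (fun c X Y => by simp only [formDβ, Matrix.smul_mul, Matrix.mul_smul, sub_mul,
      Matrix.trace_smul, Matrix.trace_sub, smul_sub])

theorem mem_lieCentralizer {k : Type*} [CommRing k] {n : ℕ} {β X : Mat n k} :
    X ∈ lieCentralizer β ↔ X ∈ lieSp n k ∧ β * X = X * β := by
  rw [lieCentralizer, Submodule.mem_inf, Subalgebra.mem_toSubmodule, Subalgebra.mem_centralizer_iff]
  simp

theorem formDβ_of_mem_lieCentralizer {k : Type*} [CommRing k] {n : ℕ} {β X : Mat n k}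
    (hX : X ∈ lieCentralizer β) (Y : Mat n k) : formDβ β X Y = 0 := by
  rw [formDβ_eq, (mem_lieCentralizer.1 hX).2, sub_self, mul_zero, Matrix.trace_zero]

theorem formDβ_swap {k : Type*} [CommRing k] {n : ℕ} (β X Y : Mat n k) :
    formDβ β X Y = -formDβ β Y X := by
  rw [formDβ, formDβ, ← Matrix.trace_neg, ← neg_mul, neg_sub]

/-- The radical of `D_β` on the symplectic Lie algebra is the centralizer of `β`. -/
theorem mem_lieCentralizer_of_formDβ {k : Type*} [CommRing k] {n : ℕ} (h2 : IsUnit (2 : k))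
    {β X : Mat n k} (hβ : β ∈ lieSp n k) (hX : X ∈ lieSp n k)
    (h : ∀ Y ∈ lieSp n k, formDβ β X Y = 0) : X ∈ lieCentralizer β := by
  refine mem_lieCentralizer.2 ⟨hX, sub_eq_zero.1 ?_⟩
  exact eq_zero_of_trace_mul_eq_zero h2 (commutator_mem_lieSp hβ hX) fun Y hY => by
    rw [← formDβ_eq]
    exact h Y hY

/-- An element of W' orthogonal to W is orthogonal to all of 𝔤, since W' is isotropic and 𝔤_β lies
in the radical. It therefore lies in 𝔤_β and vanishes. So W' embeds in the dual of W, and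
conversely, giving |W'| = |W|. -/
theorem card_polarization {k : Type*} [Field k] [Finite k] {n : ℕ} (h2 : IsUnit (2 : k))
    {β : Mat n k} (hβ : β ∈ lieSp n k) {W' W : Submodule k (Mat n k)} (hd : Disjoint W' W)
    (hdβ : Disjoint (W' ⊔ W) (lieCentralizer β)) (hs : W' ⊔ W ⊔ lieCentralizer β = lieSp n k)
    (hW' : ∀ X ∈ W', ∀ Y ∈ W', formDβ β X Y = 0) (hW : ∀ X ∈ W, ∀ Y ∈ W, formDβ β X Y = 0) :
    Nat.card W' ^ 2 * Nat.card (lieCentralizer β) = Nat.card (lieSp n k) := by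
  have hle' : W' ≤ lieSp n k := (le_sup_left.trans le_sup_left).trans hs.le
  have hle : W ≤ lieSp n k := (le_sup_right.trans le_sup_left).trans hs.le
  have key : ∀ U U' : Submodule k (Mat n k), U' ⊔ U ⊔ lieCentralizer β = lieSp n k →
      (∀ X ∈ U', ∀ Y ∈ U', formDβ β X Y = 0) → Disjoint U' (lieCentralizer β) →
      Nat.card U' ≤ Nat.card U := by
    intro U U' hs hU hdis
    refine card_isotropic_le (bilinβ β) U' U fun X hX h => ?_
    have hXs : X ∈ lieSp n k := hs ▸ Submodule.mem_sup_left (Submodule.mem_sup_left hX)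
    refine (Submodule.disjoint_def.1 hdis) X hX (mem_lieCentralizer_of_formDβ h2 hβ hXs ?_)
    intro Y hY
    rw [← hs] at hY
    obtain ⟨Z, hZ, Y₃, hY₃, rfl⟩ := Submodule.mem_sup.1 hY
    obtain ⟨Y₁, hY₁, Y₂, hY₂, rfl⟩ := Submodule.mem_sup.1 hZ
    have e : ∀ Y, formDβ β X Y = bilinβ β X Y := fun _ => rfl
    rw [e, map_add, map_add, h Y₂ hY₂, ← e, ← e, hU X hX Y₁ hY₁, formDβ_swap,
      formDβ_of_mem_lieCentralizer hY₃]
    simp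
  have h1 := key W W' hs hW' (hdβ.mono_left le_sup_left)
  have h3 := key W' W (by rw [sup_comm W W', hs]) hW (hdβ.mono_left le_sup_right)
  rw [← hs, card_sup_of_disjoint hdβ, card_sup_of_disjoint hd, le_antisymm h1 h3, pow_two]

/-- The size of a polarization, when the centralizer of `β` has dimension `n`. -/
theorem card_polarization_eq {k : Type*} [CommRing k] [Finite k] (hk : IsField k) {n : ℕ}
    (h2 : IsUnit (2 : k)) {β : Mat n k} (hβ : β ∈ lieSp n k) {W' W : Submodule k (Mat n k)}
    (hd : Disjoint W' W) (hdβ : Disjoint (W' ⊔ W) (lieCentralizer β))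
    (hs : W' ⊔ W ⊔ lieCentralizer β = lieSp n k)
    (hW' : ∀ X ∈ W', ∀ Y ∈ W', formDβ β X Y = 0) (hW : ∀ X ∈ W, ∀ Y ∈ W, formDβ β X Y = 0)
    (hc : Nat.card (lieCentralizer β) = Nat.card k ^ n) :
    Nat.card W' = Nat.card k ^ n ^ 2 := by
  have h := @card_polarization k hk.toField _ n h2 β hβ W' W hd hdβ hs hW' hW
  have : 0 < Nat.card k := by
    have := hk.nontrivial
    exact Nat.card_pos
  -- The exponents match because dim 𝔤 = 2n² + n and dim 𝔤_β = n.
  have h3 : Nat.card W' ^ 2 * Nat.card k ^ n = (Nat.card k ^ n ^ 2) ^ 2 * Nat.card k ^ n := by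
    rw [← hc]
    refine h.trans ?_
    rw [card_lieSp, hc, ← pow_mul, ← pow_add]
    ring_nf
  exact Nat.pow_left_injective two_ne_zero (Nat.eq_of_mul_eq_mul_right (by positivity) h3)

end Polarization
-- Powers of q in the order of the symplectic group
section Numerics

/-- The k-th factor of the group order contributes |R| to the power (2k+2) + (2k+1); the total is
the dimension of the symplectic group. -/
theorem sum_exponents (n : ℕ) : ∑ k ∈ Finset.range n, (4 * k + 3) = 2 * n ^ 2 + n := by
  induction n with
  | zero => rfl
  | succ n ih => rw [Finset.sum_range_succ, ih]; ring

/-- The order of `Sp_{2n}` over a ring with `q ^ m` elements and maximal ideal of `q ^ (m - 1)`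
elements. -/
theorem cast_card_symplectic (q n m : ℕ) (hq : 0 < q) :
    ((∏ k ∈ Finset.range n, ((q ^ (m + 1)) ^ (2 * (k + 1)) - (q ^ m) ^ (2 * (k + 1))) *
      (q ^ (m + 1)) ^ (2 * k + 1) : ℕ) : ℝ) =
    (q : ℝ) ^ ((m + 1) * (2 * n ^ 2 + n)) *
      ∏ k ∈ Finset.Icc 1 n, (1 - ((q : ℝ) ^ (2 * k))⁻¹) := by
  have hq' : (q : ℝ) ≠ 0 := by positivity
  have hI : ∏ k ∈ Finset.Icc 1 n, (1 - ((q : ℝ) ^ (2 * k))⁻¹) =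
      ∏ k ∈ Finset.range n, (1 - ((q : ℝ) ^ (2 * (k + 1)))⁻¹) := by
    rw [Finset.range_eq_Ico, Finset.prod_Ico_add' (fun k => 1 - ((q : ℝ) ^ (2 * k))⁻¹) 0 n 1]
    rfl
  rw [hI, ← sum_exponents, Finset.mul_sum, ← Finset.prod_pow_eq_pow_sum,
    ← Finset.prod_mul_distrib, Nat.cast_prod]
  refine Finset.prod_congr rfl fun k _ => ?_
  have hle : (q ^ m) ^ (2 * (k + 1)) ≤ (q ^ (m + 1)) ^ (2 * (k + 1)) :=
    Nat.pow_le_pow_left (Nat.pow_le_pow_right hq m.le_succ) _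
  push_cast [Nat.cast_sub hle]
  field_simp
  ring

end Numerics

/-! ### Residue degrees and non-squareness of d -/

theorem card_quotient_eq_pow_inertiaDeg {A B : Type*} [CommRing A] [CommRing B] [Algebra A B]
    [Module.Finite A B] (p : Ideal A) (P : Ideal B) [p.IsMaximal] [P.IsMaximal] [P.LiesOver p] :
    Nat.card (B ⧸ P) = Nat.card (A ⧸ p) ^ P.inertiaDeg A := by
  let _ := Ideal.Quotient.field p
  rw [Ideal.inertiaDeg_eq_of_isMaximal p P]
  exact Module.natCard_eq_pow_finrank (K := A ⧸ p)

/-- If the prime element `π` of `P` remains prime in `A`, then `d` is not a square modulo `π`. -/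
theorem InvolutiveAlgebra.isUnit_of_dvd_sq_sub {O P A : Type*} [CommRing O] [CommRing P]
    [CommRing A] [Algebra O P] [Algebra O A] {n : ℕ} (E : InvolutiveAlgebra O P A n) {I : Ideal A}
    (hI : I.IsPrime) {π : P} (h : ∀ x, x ∈ I ↔ E.incl π ∣ x) {c : P} (hc : π ∣ c ^ 2 - E.d) :
    IsUnit π := by
  have h1 := map_dvd E.incl hc
  -- Factor c² - d as (c + ω)(c - ω). Primality puts one factor in I, and then π divides its
  -- ω-component ±1.
  have e : E.incl (c ^ 2 - E.d) = E.comps (c, 1) * E.comps (c, -1) := by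
    rw [E.comps_apply, E.comps_apply, map_sub, map_pow, ← E.sq_ω, map_neg, map_one]
    ring
  rw [e, ← h] at h1
  rcases hI.mem_or_mem h1 with h' | h'
  · rw [h, E.incl_dvd_comps] at h'
    exact isUnit_of_dvd_one h'.2
  · rw [h, E.incl_dvd_comps] at h'
    exact isUnit_of_dvd_one ((dvd_neg).1 h'.2)

/-! ### Reduction maps, index of the stabilizer, and orders of the groups -/

namespace Datum

theorem nontrivial_quotient_pow {A : Type*} [CommRing A] {x : A} (hx : ¬ IsUnit x) {m : ℕ}
    (hm : 0 < m) : Nontrivial (A ⧸ Ideal.span {x ^ m}) := by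
  rw [Ideal.Quotient.nontrivial_iff, Ne, Ideal.span_singleton_eq_top]
  exact fun h => hx ((isUnit_pow_iff hm.ne').1 h)

section Reduction

variable {p : ℕ} [Fact p.Prime] {F Kp K : Type*} [Field F] [Algebra ℤ_[p] F] [Field Kp]
  [Algebra F Kp] [Field K] [Algebra Kp K] [Algebra F K] {n : ℕ} (D : Datum p F Kp K n)

theorem transMat_redMat {m r : ℕ} (h : m ≤ r) (X : Mat n (IntF p F)) :
    D.transMat h (D.redMat r X) = D.redMat m X := rfl

theorem redMat_surjective (r : ℕ) : Function.Surjective (D.redMat r) :=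
  InvolutiveAlgebra.red_surjective _

theorem transMat_refl (r : ℕ) (X : Mat n (D.R r)) : D.transMat le_rfl X = X := by
  obtain ⟨X, rfl⟩ := D.redMat_surjective r X
  rfl

theorem transMat_transMat {m r s : ℕ} (h : m ≤ r) (h' : r ≤ s) (X : Mat n (D.R s)) :
    D.transMat h (D.transMat h' X) = D.transMat (h.trans h') X := by
  obtain ⟨X, rfl⟩ := D.redMat_surjective s X
  rw [transMat_redMat, transMat_redMat, transMat_redMat]

/-- Reduction of the symplectic group. -/
def transG {m r : ℕ} (h : m ≤ r) : D.G r →* D.G m where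
  toFun g := ⟨D.transMat h g, SymplecticGroup.map_mem g.2 _⟩
  map_one' := Subtype.ext (map_one _)
  map_mul' _ _ := Subtype.ext (map_mul _ _ _)

/-- The kernel of O_F/𝔭^(m+1) → O_F/𝔭^m has square zero because 2m ≥ m + 1; this is where m > 0
enters. -/
theorem transG_surjective_succ (h2 : IsUnit (2 : IntF p F)) {m : ℕ} (hm : 0 < m) :
    Function.Surjective (D.transG m.le_succ) := by
  intro g
  let f : D.R (m + 1) →+* D.R m := Ideal.Quotient.factor
    (Ideal.span_singleton_le_span_singleton.mpr (pow_dvd_pow D.varpi m.le_succ))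
  have hf : ∀ a, f (Ideal.Quotient.mk _ a) = Ideal.Quotient.mk _ a := fun _ => rfl
  have hfs : Function.Surjective f := fun x => by
    obtain ⟨a, rfl⟩ := Ideal.Quotient.mk_surjective x
    exact ⟨Ideal.Quotient.mk _ a, rfl⟩
  have hker : ∀ x ∈ RingHom.ker f, ∀ y ∈ RingHom.ker f, x * y = 0 := by
    intro x hx y hy
    obtain ⟨a, rfl⟩ := Ideal.Quotient.mk_surjective x
    obtain ⟨b, rfl⟩ := Ideal.Quotient.mk_surjective y
    rw [RingHom.mem_ker, hf, Ideal.Quotient.eq_zero_iff_mem, Ideal.mem_span_singleton] at hx hy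
    rw [← map_mul, Ideal.Quotient.eq_zero_iff_mem, Ideal.mem_span_singleton]
    refine (pow_dvd_pow D.varpi (show m + 1 ≤ m + m by omega)).trans ?_
    rw [pow_add]
    exact mul_dvd_mul hx hy
  have h2' : IsUnit (2 : D.R (m + 1)) := by
    have := h2.map (Ideal.Quotient.mk (Ideal.span {D.varpi ^ (m + 1)}))
    rwa [map_ofNat] at this
  obtain ⟨g', hg', h⟩ := exists_symplectic_lift f hfs hker h2' g.2
  exact ⟨⟨g', hg'⟩, Subtype.ext h⟩

theorem transG_surjective (h2 : IsUnit (2 : IntF p F)) {m r : ℕ} (hm : 0 < m) (h : m ≤ r) :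
    Function.Surjective (D.transG h) := by
  induction r, h using Nat.le_induction with
  | base => exact fun g => ⟨g, Subtype.ext (D.transMat_refl m _)⟩
  | succ r h ih =>
    intro g
    obtain ⟨g₁, hg₁⟩ := ih g
    obtain ⟨g₂, hg₂⟩ := D.transG_surjective_succ h2 (hm.trans_le h) g₁
    refine ⟨g₂, ?_⟩
    rw [← hg₁, ← hg₂]
    exact Subtype.ext (D.transMat_transMat h (Nat.le_succ r) _).symm

theorem stab_eq_comap {m r : ℕ} (h : m ≤ r) : D.stab h = (D.Gβ m).comap (D.transG h) := by
  ext g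
  change _ ↔ D.transMat le_rfl (D.transMat h g) * _ = _ * D.transMat le_rfl (D.transMat h g)
  rw [transMat_refl]
  rfl

/-- The stabilizer condition depends only on g modulo 𝔭^m and reduction is onto, so the index can be
computed at level m. -/
theorem index_stab (h2 : IsUnit (2 : IntF p F)) {m r : ℕ} (hm : 0 < m) (h : m ≤ r) :
    (D.stab h).index = (D.Gβ m).index := by
  rw [stab_eq_comap, Subgroup.index_comap_of_surjective _ (D.transG_surjective h2 hm h)]

theorem varpiP_not_isUnit : ¬ IsUnit D.varpiP := fun h =>
  D.isMaximal_varpiP.ne_top (Ideal.span_singleton_eq_top.2 h)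

theorem varpi_not_isUnit : ¬ IsUnit D.varpi := fun h =>
  D.isMaximal_varpi.ne_top (Ideal.span_singleton_eq_top.2 h)

/-- The ring `O_{K₊} / 𝔭_F^m`. -/
abbrev RP (m : ℕ) : Type _ := InvolutiveAlgebra.QuotP (IntExt p F Kp) (D.varpi ^ m)

end Reduction

section Conic

variable {p : ℕ} [Fact p.Prime] {F Kp K : Type*} [Field F] [Algebra ℤ_[p] F] [Field Kp]
  [Algebra F Kp] [Field K] [Algebra Kp K] [Algebra F K] [IsScalarTower F Kp K] {n : ℕ} (D : Datum p F Kp K n)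

theorem card_Gβ (h2 : IsUnit (2 : IntF p F)) (m : ℕ) : Nat.card (D.Gβ m) =
    Nat.card {s : D.RP m × D.RP m //
      s.1 ^ 2 - Ideal.Quotient.mk _ (D.involutive h2).d * s.2 ^ 2 = 1} := by
  rw [← InvolutiveAlgebra.card_centralizer]
  refine Nat.card_congr (Equiv.subtypeEquivRight fun g => ?_)
  change D.transMat le_rfl (g : Mat n (D.R m)) * _ = _ * D.transMat le_rfl (g : Mat n (D.R m)) ↔ _
  rw [transMat_refl]
  rfl

end Conic

section Structure

variable {p : ℕ} [Fact p.Prime] {F Kp K : Type*} [Field F] [Field Kp] [Field K]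
  [Algebra ℚ_[p] F] [FiniteDimensional ℚ_[p] F] [Algebra ℤ_[p] F] [IsScalarTower ℤ_[p] ℚ_[p] F]
  [Algebra F Kp] [Algebra Kp K] [Algebra F K] {n : ℕ} (D : Datum p F Kp K n)

theorem finite_res : Finite D.Res :=
  have := D.isMaximal_varpi
  finite_quotient_intF _

theorem q_pos : 0 < D.q :=
  have := D.finite_res
  Nat.card_pos

theorem span_varpi_eq : Ideal.span {D.varpi} =
    @IsLocalRing.maximalIdeal (IntF p F) _ (isLocalRing_intF) :=
  have := isLocalRing_intF (p := p) (F := F)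
  IsLocalRing.eq_maximalIdeal D.isMaximal_varpi

theorem card_R (m : ℕ) : Nat.card (D.R m) = D.q ^ m := by
  have := D.isMaximal_varpi
  have := isDedekindDomain_intF (p := p) (F := F)
  rw [R, ← Ideal.span_singleton_pow, card_quotient_pow _ (ne_bot_of_isMaximal_intF _)]
  rfl

theorem finite_R (m : ℕ) : Finite (D.R m) :=
  Nat.finite_of_card_ne_zero (by rw [card_R]; exact (pow_pos D.q_pos m).ne')

/-- The order of `G(O_F / 𝔭_F^m)`. -/
theorem card_G {m : ℕ} (hm : 0 < m) : (Nat.card (D.G m) : ℝ) = (D.q : ℝ) ^ (m * (2 * n ^ 2 + n)) *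
      ∏ k ∈ Finset.Icc 1 n, (1 - ((D.q : ℝ) ^ (2 * k))⁻¹) := by
  obtain ⟨m, rfl⟩ := Nat.exists_eq_add_of_lt hm
  rw [zero_add]
  have := isLocalRing_intF (p := p) (F := F)
  have := D.finite_R (m + 1)
  have := nontrivial_quotient_pow D.varpi_not_isUnit m.succ_pos
  have hloc : IsLocalRing (D.R (m + 1)) := IsLocalRing.of_surjective' _ Ideal.Quotient.mk_surjective
  have h := card_quotient_local (Ideal.span {D.varpi ^ (m + 1)})
  rw [← D.span_varpi_eq] at h
  -- The maximal ideal has index q in a ring with q^(m+1) elements.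
  have h1 : Nat.card (IsLocalRing.maximalIdeal (D.R (m + 1))) = D.q ^ m := by
    refine Nat.eq_of_mul_eq_mul_left D.q_pos ?_
    rw [← pow_succ', ← D.card_R (m + 1), h]
    rfl
  rw [card_symplecticGroup, card_R, h1, cast_card_symplectic _ _ _ D.q_pos]

theorem algebraMap_varpi_not_isUnit (L : Type*) [Field L] [Algebra F L] [FiniteDimensional F L] :
    ¬ IsUnit (algebraMap (IntF p F) (IntExt p F L) D.varpi) := by
  have := isLocalRing_intF (p := p) (F := F)
  have := isLocalRing_intExt (p := p) (F := F) (L := L)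
  have h : D.varpi ∈ (IsLocalRing.maximalIdeal (IntExt p F L)).under (IntF p F) := by
    rw [under_eq_maximalIdeal, ← D.span_varpi_eq]
    exact Ideal.mem_span_singleton_self _
  exact (IsLocalRing.mem_maximalIdeal _).1 h

variable [FiniteDimensional F Kp]

theorem maxP_eq : D.maxP = @IsLocalRing.maximalIdeal (IntExt p F Kp) _ (isLocalRing_intExt) :=
  have := isLocalRing_intExt (p := p) (F := F) (L := Kp)
  IsLocalRing.eq_maximalIdeal D.isMaximal_varpiP

theorem card_quotient_maxP : Nat.card (IntExt p F Kp ⧸ D.maxP) = D.q ^ D.fPlus := by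
  have := isLocalRing_intF (p := p) (F := F)
  have := finite_intExt (p := p) (F := F) (L := Kp)
  have h1 := D.isMaximal_varpi
  have h2 : D.maxP.IsMaximal := D.isMaximal_varpiP
  have h3 : D.maxP.LiesOver (Ideal.span {D.varpi}) :=
    ⟨by rw [under_eq_maximalIdeal, D.span_varpi_eq]⟩
  exact card_quotient_eq_pow_inertiaDeg (Ideal.span {D.varpi}) D.maxP

theorem isLocalRing_RP {m : ℕ} (hm : 0 < m) : IsLocalRing (D.RP m) := by
  have := isLocalRing_intExt (p := p) (F := F) (L := Kp)
  have : Nontrivial (D.RP m) := by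
    rw [RP, InvolutiveAlgebra.QuotP, map_pow]
    exact nontrivial_quotient_pow (D.algebraMap_varpi_not_isUnit Kp) hm
  exact IsLocalRing.of_surjective' _ Ideal.Quotient.mk_surjective

end Structure

section Count

variable {p : ℕ} [Fact p.Prime] {F Kp K : Type*} [Field F] [Field Kp] [Field K]
  [Algebra ℚ_[p] F] [FiniteDimensional ℚ_[p] F] [Algebra ℤ_[p] F] [IsScalarTower ℤ_[p] ℚ_[p] F]
  [Algebra F Kp] [Algebra Kp K] [Algebra F K] [IsScalarTower F Kp K] {n : ℕ}
  (D : Datum p F Kp K n)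

theorem card_RP (h2 : IsUnit (2 : IntF p F)) (m : ℕ) : Nat.card (D.RP m) = D.q ^ (m * n) := by
  rw [(D.involutive h2).card_quotP, pow_mul, ← D.card_R m]

theorem finite_RP (h2 : IsUnit (2 : IntF p F)) (m : ℕ) : Finite (D.RP m) :=
  Nat.finite_of_card_ne_zero (by rw [D.card_RP h2]; exact (pow_pos D.q_pos _).ne')

/-- The residue of β lies in 𝔤(𝔽) because τ(β) + β = 0, and 𝔤_β(𝔽) has as many elements as
O_{K₊}/𝔭_F, namely q^n. -/
theorem card_polarization_res (h2 : IsUnit (2 : IntF p F)) {W' W : Submodule D.Res (Mat n D.Res)}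
    (h : D.IsPolarization W' W) : Nat.card W' = D.q ^ n ^ 2 := by
  have := D.finite_res
  have h2' : IsUnit (2 : D.Res) := by
    have := h2.map (Ideal.Quotient.mk (Ideal.span {D.varpi}))
    rwa [map_ofNat] at this
  have hβ : D.βbar ∈ lieSp n D.Res :=
    ((D.involutive h2).red_mat_mem_lieSp (c := D.varpi) (a := D.β)).2 (by
      have : (D.involutive h2).tau D.β + D.β = 0 := Subtype.ext D.τ_β
      rw [this]
      exact dvd_zero _)
  exact card_polarization_eq ((Ideal.Quotient.maximal_ideal_iff_isField_quotient _).1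
      D.isMaximal_varpi) h2' hβ h.disjoint h.disjoint_gβ h.sup_eq h.isotropic' h.isotropic
      (((D.involutive h2).card_lieCentralizer D.varpi).trans ((D.involutive h2).card_quotP D.varpi))

variable [FiniteDimensional F Kp]

/-- The order of `G_β` in the unramified case. -/
theorem card_Gβ_unramified (h2 : IsUnit (2 : IntF p F)) (hu : D.IsUnramified) {m : ℕ}
    (hm : 0 < m) : ∃ s, Nat.card (D.Gβ m) = D.q ^ (m * n) + s ∧
      D.q ^ D.fPlus * s = D.q ^ (m * n) := by
  have := isLocalRing_intExt (p := p) (F := F) (L := Kp)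
  have := D.isLocalRing_RP hm
  have := D.finite_RP h2 m
  have h2' : IsUnit (2 : D.RP m) := by
    have := h2.map (algebraMap (IntF p F) (D.RP m))
    rwa [map_ofNat] at this
  -- The extra term is |𝔪_S| for S = O_{K₊}/𝔭_F^m, and 𝔪_S has index q^(f₊) in S.
  refine ⟨Nat.card (IsLocalRing.maximalIdeal (D.RP m)), ?_, ?_⟩
  · rw [D.card_Gβ h2, card_conic_of_nonsquare h2', D.card_RP h2]
    intro c
    obtain ⟨c, rfl⟩ := Ideal.Quotient.mk_surjective c
    rw [← map_pow, ← map_sub]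
    refine IsUnit.map _ ?_
    -- A nonunit c² - d would be divisible by ϖ_{K₊}, which remains prime in O_K when K/K₊ is
    -- unramified.
    by_contra hc
    have hdvd : D.varpiP ∣ c ^ 2 - (D.involutive h2).d := by
      rw [← Ideal.mem_span_singleton]
      change _ ∈ D.maxP
      rw [D.maxP_eq]
      exact (IsLocalRing.mem_maximalIdeal _).2 hc
    refine D.varpiP_not_isUnit ((D.involutive h2).isUnit_of_dvd_sq_sub D.isMaximal_maxK.isPrime
      (fun x => (hu x).trans (exists_congr fun y => ?_)) hdvd)
    exact ⟨fun h => Subtype.ext h, fun h => congrArg Subtype.val h⟩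
  · have h := card_quotient_local
      (Ideal.span {algebraMap (IntF p F) (IntExt p F Kp) (D.varpi ^ m)})
    rw [← D.maxP_eq, D.card_quotient_maxP] at h
    rw [← D.card_RP h2 m]
    exact h.symm

end Count

end Datum

/-! ### Total ramification leaves the residue field unchanged -/

/-- From pB ⊆ P^e one gets |B/P|^e ≤ |B/pB| = |A/p|^e, and e-th roots can be taken. -/
theorem card_quotient_le_of_ramificationIdx {A B : Type*} [CommRing A] [CommRing B]
    [IsDedekindDomain B] [Algebra A B] (p : Ideal A) (P : Ideal B) [P.IsMaximal] [P.LiesOver p]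
    (hp : p.map (algebraMap A B) ≠ ⊥) (h0 : P.ramificationIdx A ≠ 0)
    (h : Nat.card (B ⧸ p.map (algebraMap A B)) = Nat.card (A ⧸ p) ^ P.ramificationIdx A)
    [Finite (A ⧸ p)] : Nat.card (B ⧸ P) ≤ Nat.card (A ⧸ p) := by
  have hle : p.map (algebraMap A B) ≤ P ^ P.ramificationIdx A := by
    rw [← Ideal.ramificationIdx'_eq_ramificationIdx' p P hp]
    exact Ideal.le_pow_ramificationIdx'
  have hP : P ≠ ⊥ := ne_bot_of_le_ne_bot hp (hle.trans (Ideal.pow_le_self h0))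
  rcases isEmpty_or_nonempty (A ⧸ p) with he | he
  · exact (he.false 0).elim
  have hfin : Finite (B ⧸ p.map (algebraMap A B)) :=
    Nat.finite_of_card_ne_zero (by rw [h]; exact (pow_pos Nat.card_pos _).ne')
  have := Nat.card_le_card_of_surjective _ (Ideal.Quotient.factor_surjective hle)
  rw [h, card_quotient_pow P hP] at this
  exact (Nat.pow_le_pow_iff_left h0).1 this

/-- The embedding of residue fields is bijective by cardinality, so every residue class comes from
A. -/
theorem exists_sub_mem_of_card_le {A B : Type*} [CommRing A] [CommRing B] [Algebra A B]
    (p : Ideal A) (P : Ideal B) [p.IsMaximal] [P.IsPrime] [P.LiesOver p] [Finite (A ⧸ p)]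
    [Module.Finite A B]
    (h : Nat.card (B ⧸ P) ≤ Nat.card (A ⧸ p)) (x : B) : ∃ c : A, x - algebraMap A B c ∈ P := by
  let _ := Ideal.Quotient.field p
  have : Finite (B ⧸ P) := Module.finite_of_finite (A ⧸ p)
  have hinj : Function.Injective (algebraMap (A ⧸ p) (B ⧸ P)) := RingHom.injective _
  obtain ⟨c, hc⟩ := ((Nat.bijective_iff_injective_and_card _).2
    ⟨hinj, le_antisymm (Nat.card_le_card_of_injective _ hinj) h⟩).2 (Ideal.Quotient.mk P x)
  obtain ⟨c, rfl⟩ := Ideal.Quotient.mk_surjective c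
  exact ⟨c, Ideal.Quotient.eq.1 hc.symm⟩

/-- If the residue field of `A` is that of `O`, then `d` is not a unit. -/
theorem InvolutiveAlgebra.not_isUnit_d {O P A : Type*} [CommRing O] [CommRing P]
    [CommRing A] [IsLocalRing A] [Algebra O P] [Algebra O A] {n : ℕ}
    (E : InvolutiveAlgebra O P A n)
    (h : ∃ c : O, E.ω - algebraMap O A c ∈ IsLocalRing.maximalIdeal A) : ¬ IsUnit E.d := by
  obtain ⟨c, hc⟩ := h
  intro hd
  have hω : IsUnit E.ω := by
    have := hd.map E.incl
    rw [← E.sq_ω] at this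
    exact (isUnit_pow_iff two_ne_zero).1 this
  have htau : ∀ x, E.tau (E.tau x) = x := by
    intro x
    obtain ⟨⟨a, b⟩, rfl⟩ := E.comps.surjective x
    rw [E.tau_decomp, map_sub, map_mul, E.tau_incl, E.tau_incl, E.tau_ω, E.comps_apply]
    ring
  -- Applying τ to ω ≡ c gives -ω ≡ c, so 2ω lies in the maximal ideal, contradicting that 2 and ω
  -- are units.
  have hc' : E.tau (E.ω - algebraMap O A c) ∈ IsLocalRing.maximalIdeal A := by
    rw [IsLocalRing.mem_maximalIdeal, mem_nonunits_iff] at hc ⊢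
    intro hu
    exact hc (by simpa only [htau] using hu.map E.tau)
  have h2 := sub_mem hc hc'
  rw [map_sub, E.tau_ω, AlgHom.commutes] at h2
  have e : E.ω - algebraMap O A c - (-E.ω - algebraMap O A c) = algebraMap O A 2 * E.ω := by
    rw [map_ofNat]; ring
  rw [e] at h2
  exact (IsLocalRing.mem_maximalIdeal _).1 h2 ((E.isUnit_two.map (algebraMap O A)).mul hω)

theorem mk_mem_maximalIdeal {A : Type*} [CommRing A] [IsLocalRing A] {I : Ideal A}
    [IsLocalRing (A ⧸ I)] {x : A} (hx : ¬ IsUnit x) :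
    Ideal.Quotient.mk I x ∈ IsLocalRing.maximalIdeal (A ⧸ I) := by
  have : IsLocalHom (Ideal.Quotient.mk I) :=
    IsLocalHom.of_surjective _ Ideal.Quotient.mk_surjective
  exact (IsLocalRing.mem_maximalIdeal _).2 fun h => hx (isUnit_of_map_unit _ _ h)

/-! ### Assembling the dimension; the totally ramified centralizer -/

namespace Datum

variable {p : ℕ} [Fact p.Prime] {F Kp K : Type*} [Field F] [Field Kp] [Field K]
  [Algebra ℚ_[p] F] [FiniteDimensional ℚ_[p] F] [Algebra ℤ_[p] F] [IsScalarTower ℤ_[p] ℚ_[p] F]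
  [Algebra F Kp] [Algebra Kp K] [Algebra F K] [IsScalarTower F Kp K] {n : ℕ}
  (D : Datum p F Kp K n)

/-- The dimension of `δ_{β,θ}` times the order of `G_β(O_F / 𝔭_F^{l'})`. -/
theorem finrank_delta_mul (h2 : IsUnit (2 : IntF p F)) {r : ℕ} (hr : 1 < r)
    {θ : NormOne p F Kp K →* Circle} {V : Type*} [AddCommGroup V] [Module ℂ V]
    {δ : Representation ℂ (D.G r) V} (hδ : D.IsDelta r θ δ) :
    finrank ℂ V * Nat.card (D.Gβ (r / 2)) =
      Nat.card (D.G (r / 2)) * D.q ^ (n ^ 2 * (r % 2)) := by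
  have := D.finite_R r
  have hm : 0 < r / 2 := by omega
  have hind := (D.Gβ (r / 2)).index_mul_card
  rw [← D.index_stab h2 hm (Nat.div_le_self r 2)] at hind
  rw [← hind]
  rcases hδ with ⟨he, σ, -, ⟨e⟩⟩ | ⟨ho, W', W, σ, hW, -, ⟨e⟩⟩
  · rw [e.toLinearEquiv.finrank_eq, finrank_coind, finrank_self, Nat.even_iff.1 he, mul_zero,
      pow_zero, mul_one, mul_one]
  · have := D.finite_res
    have := Fintype.ofFinite W'
    rw [e.toLinearEquiv.finrank_eq, finrank_coind, finrank_pi, ← Nat.card_eq_fintype_card,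
      D.card_polarization_res h2 hW, Nat.odd_iff.1 ho, mul_one]
    ring

/-- The real number `dim δ · |G_β|`. -/
theorem cast_finrank_delta_mul (h2 : IsUnit (2 : IntF p F)) {r : ℕ} (hr : 1 < r)
    {θ : NormOne p F Kp K →* Circle} {V : Type*} [AddCommGroup V] [Module ℂ V]
    {δ : Representation ℂ (D.G r) V} (hδ : D.IsDelta r θ δ) :
    (finrank ℂ V : ℝ) * (Nat.card (D.Gβ (r / 2)) : ℝ) =
      (D.q : ℝ) ^ (n ^ 2 * r) * (∏ k ∈ Finset.Icc 1 n, (1 - ((D.q : ℝ) ^ (2 * k))⁻¹)) *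
        (D.q : ℝ) ^ (r / 2 * n) := by
  have h := congrArg (Nat.cast (R := ℝ)) (D.finrank_delta_mul h2 hr hδ)
  rw [Nat.cast_mul, Nat.cast_mul, D.card_G (show 0 < r / 2 by omega), Nat.cast_pow] at h
  rw [h, mul_right_comm, ← pow_add, mul_right_comm (_ ^ _), ← pow_add]
  congr 2
  -- With m = r/2, this gives m(2n² + n) + n²(r mod 2) = n²r + mn.
  have e : n ^ 2 * r = n ^ 2 * (2 * (r / 2) + r % 2) := by rw [Nat.div_add_mod]
  rw [e]
  ring

variable [FiniteDimensional F K]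

/-- Here e = 2n and |O_K/ϖ_F| = q^(2n) leave no residue extension, so ω is congruent to an element
of O_F; this is what prevents d = ω² from being a unit. -/
theorem exists_ω_sub_mem (h2 : IsUnit (2 : IntF p F)) (hn : finrank F K = 2 * n) (hn0 : n ≠ 0)
    (ht : D.IsTotallyRamified) : ∃ c, D.ω - algebraMap (IntF p F) (IntExt p F K) c ∈ D.maxK := by
  have := isLocalRing_intF (p := p) (F := F)
  have := finite_intExt (p := p) (F := F) (L := K)
  have := isDedekindDomain_intExt (p := p) (F := F) (L := K)
  have h1 := D.isMaximal_varpi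
  have h3 := D.isMaximal_maxK
  have h4 : D.maxK.LiesOver (Ideal.span {D.varpi}) :=
    ⟨by rw [under_eq_maximalIdeal, D.span_varpi_eq]⟩
  have := D.finite_res
  have hne : (Ideal.span {D.varpi}).map (algebraMap (IntF p F) (IntExt p F K)) ≠ ⊥ := by
    rw [Ideal.map_span, Set.image_singleton, Ne, Ideal.span_singleton_eq_bot]
    intro h
    refine ne_bot_of_isMaximal_intF (Ideal.span {D.varpi}) (Ideal.span_singleton_eq_bot.2 ?_)
    exact Subtype.ext ((algebraMap F K).injective ((congrArg Subtype.val h).trans (map_zero _).symm))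
  have ht' : D.maxK.ramificationIdx (IntF p F) = 2 * n := ht.trans hn
  have hle := card_quotient_le_of_ramificationIdx (Ideal.span {D.varpi}) D.maxK hne
    (by rw [ht']; omega) (by
      rw [ht', Ideal.map_span, Set.image_singleton]
      exact (D.involutive h2).card_quotA (c := D.varpi))
  exact exists_sub_mem_of_card_le (Ideal.span {D.varpi}) D.maxK hle D.ω

variable [FiniteDimensional F Kp]

/-- The order of `G_β` in the totally ramified case. -/
theorem card_Gβ_ramified (h2 : IsUnit (2 : IntF p F)) (hn : finrank F K = 2 * n) (hn0 : n ≠ 0)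
    (ht : D.IsTotallyRamified) {m : ℕ} (hm : 0 < m) :
    Nat.card (D.Gβ m) = 2 * D.q ^ (m * n) := by
  have := isLocalRing_intExt (p := p) (F := F) (L := Kp)
  have := isLocalRing_intExt (p := p) (F := F) (L := K)
  have := D.isLocalRing_RP hm
  have := D.finite_RP h2 m
  have h2' : IsUnit (2 : D.RP m) := by
    have := h2.map (algebraMap (IntF p F) (D.RP m))
    rwa [map_ofNat] at this
  have hK : D.maxK = IsLocalRing.maximalIdeal (IntExt p F K) :=
    IsLocalRing.eq_maximalIdeal D.isMaximal_maxK
  have hd : ¬ IsUnit (D.involutive h2).d := (D.involutive h2).not_isUnit_d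
    (by rw [← hK]; exact D.exists_ω_sub_mem h2 hn hn0 ht)
  rw [D.card_Gβ h2, card_conic_of_mem h2' (mk_mem_maximalIdeal hd), D.card_RP h2]

end Datum

end TameSymplectic

end

/-! ### The dimension formula -/

theorem mainTheorem9 (p : ℕ) [Fact p.Prime] (hp : p ≠ 2)
    {F Kp K : Type*} [Field F] [Field Kp] [Field K]
    [Algebra ℚ_[p] F] [FiniteDimensional ℚ_[p] F]
    [Algebra ℤ_[p] F] [IsScalarTower ℤ_[p] ℚ_[p] F]
    [Algebra F Kp] [Algebra Kp K] [Algebra F K] [IsScalarTower F Kp K]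
    (n : ℕ) (hn : 1 < n) (hKp : Module.finrank F Kp = n) (hK : Module.finrank Kp K = 2)
    (D : TameSymplectic.Datum p F Kp K n)
    (htame : ¬ p ∣ D.ePlus)
    (hram : D.IsUnramified ∨ D.IsTotallyRamified)
    (r : ℕ) (hr : 1 < r)
    (θ : TameSymplectic.NormOne p F Kp K →* Circle) (hθ : D.IsAdmissible r θ)
    {V : Type*} [AddCommGroup V] [Module ℂ V]
    (δ : Representation ℂ (D.G r) V) (hδ : D.IsDelta r θ δ) :
    (D.IsTotallyRamified →
      (Module.finrank ℂ V : ℝ) =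
        (D.q : ℝ) ^ (n ^ 2 * r) * (∏ k ∈ Finset.Icc 1 n, (1 - ((D.q : ℝ) ^ (2 * k))⁻¹)) *
          (1 / 2)) ∧
    (D.IsUnramified →
      (Module.finrank ℂ V : ℝ) =
        (D.q : ℝ) ^ (n ^ 2 * r) * (∏ k ∈ Finset.Icc 1 n, (1 - ((D.q : ℝ) ^ (2 * k))⁻¹)) *
          (1 / (1 + ((D.q : ℝ) ^ D.fPlus)⁻¹))) := by
  have : FiniteDimensional F Kp := .of_finrank_pos (by omega)
  have : FiniteDimensional Kp K := .of_finrank_pos (by omega)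
  have : FiniteDimensional F K := .trans F Kp K
  have h2 := TameSymplectic.isUnit_two_intF (F := F) hp
  have hm : 0 < r / 2 := by omega
  have hq : (0 : ℝ) < D.q := Nat.cast_pos.2 D.q_pos
  have h := D.cast_finrank_delta_mul h2 hr hδ
  have hpow : (0 : ℝ) < (D.q : ℝ) ^ (r / 2 * n) := pow_pos hq _
  constructor
  · intro ht
    have hn' : Module.finrank F K = 2 * n := by
      rw [← Module.finrank_mul_finrank F Kp K, hKp, hK, mul_comm]
    rw [D.card_Gβ_ramified h2 hn' (by omega) ht hm, Nat.cast_mul, Nat.cast_pow, Nat.cast_ofNat,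
      ← mul_assoc] at h
    rw [← mul_right_cancel₀ hpow.ne' h]
    ring
  · intro hu
    obtain ⟨s, hs, hs'⟩ := D.card_Gβ_unramified h2 hu hm
    have hs'' : (D.q : ℝ) ^ D.fPlus * s = (D.q : ℝ) ^ (r / 2 * n) := by exact_mod_cast hs'
    have hf : (0 : ℝ) < (D.q : ℝ) ^ D.fPlus := pow_pos hq _
    -- Solving for s gives |G_β| = q^(mn)(1 + q^(-f₊)) with m = r/2; the factor q^(mn) then cancels.
    have hs3 : (s : ℝ) = (D.q : ℝ) ^ (r / 2 * n) * ((D.q : ℝ) ^ D.fPlus)⁻¹ := by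
      rw [← hs'', mul_comm, inv_mul_cancel_left₀ hf.ne']
    rw [hs, Nat.cast_add, Nat.cast_pow, hs3, ← mul_one_add, mul_left_comm, mul_comm] at h
    rw [mul_one_div, eq_div_iff (by positivity)]
    exact mul_right_cancel₀ hpow.ne' h
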